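/- Let $S^2\subset\mathbb R^3$ be the unit sphere with its surface measure, $\Delta$ its Laplace--Beltrami operator, $X_3=x_1\partial_2-x_2\partial_1$ the vector field generating the $2\pi$-periodic rotation about the $x_3$-axis, $L^2_b(S^2)=\{f\in L^2(S^2;\mathbb C):\int_{S^2} f\,dS=0\}$, and $V_1=\{f\in L^2_b(S^2): X_3f=if\}$ (in the sense of distributions). For $\zeta\in V_1$ let $\Delta^{-1}\zeta$ be the solution $\eta\in L^2_b(S^2)$ of $\Delta\eta=\zeta$ (in the sense of distributions). Take $A(x_3)=x_3$ and $B(x_3)=\Omega+6x_3$ with $\Omega=0$, and let $$M_1\zeta=A(x_3)\zeta+B(x_3)\Delta^{-1}\zeta=x_3\zeta+6x_3\Delta^{-1}\zeta,\qquad \zeta\in V_1 .$$ For $\ell\ge 1$ let $\zeta_\ell=\sqrt{\tfrac{2\ell+1}{2\ell(\ell+1)}}\,(x_1+ix_2)\,P_\ell'(x_3)$, where $P_\ell$ is the $\ell$-th Legendre polynomial, and let $V_{12}$ be the closed linear span of $\{\zeta_\ell:\ell\ge 2\}$ in $L^2(S^2)$. Then: (0) For each $\zeta\in V_1$ there is exactly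 one such $\eta=\Delta^{-1}\zeta$, and $M_1$ is a bounded linear operator from $V_1$ to $V_1$. (i) $M_1$ has only real spectrum on $V_1$: $\operatorname{Spec}(M_1)\subset\mathbb R$. (ii) $V_{12}\subset V_1$ and the range of $M_1$ is contained in $V_{12}$. The operator $I+6\Delta^{-1}$ maps $V_{12}$ into itself and is bounded and positive semidefinite there, and $M_1\zeta=x_3\,(I+6\Delta^{-1})\zeta$ for $\zeta\in V_{12}$. (iii) Nevertheless there is (weak) linear instability: $\zeta_1,\zeta_2\in V_1$, $M_1\zeta_1\ne 0$, $M_1^2\zeta_1=0$, and $$e^{itM_1}\zeta_1=\zeta_1-\frac{2it}{\sqrt5}\,\zeta_2\qquad(t\in\mathbb R),$$ and the group $\{e^{itM_1}:t\in\mathbb R\}$ is not uniformly bounded on $V_1$. -/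

import Mathlib

open MeasureTheory Polynomial
open scoped InnerProductSpace ContDiff

namespace ZonalFlow

/-- Euclidean three-space; the coordinates `x₁, x₂, x₃` are `x 0, x 1, x 2`. -/
abbrev E3 : Type := EuclideanSpace ℝ (Fin 3)

/-- The unit sphere `S²`. -/
abbrev S2 : Type := Metric.sphere (0 : E3) 1

/-- The surface (area) measure on `S²`, of total mass `4π`. -/
noncomputable abbrev area : Measure S2 := (volume : Measure E3).toSphere

/-- The complex Hilbert space `L²(S²)`. -/
abbrev L2 : Type := Lp ℂ 2 area

theorem memLp_continuous_mul (g : C(S2, ℂ)) (f : L2) :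
    MemLp (fun x => g x * f x) 2 area := by
  refine MemLp.of_le_mul (c := ‖g‖) (Lp.memLp f)
    (g.continuous.aestronglyMeasurable.mul (Lp.aestronglyMeasurable f)) ?_
  filter_upwards with x
  rw [norm_mul]
  exact mul_le_mul_of_nonneg_right (g.norm_coe_le_norm x) (norm_nonneg _)

theorem integrable_mul_continuous (f : L2) (g : C(S2, ℂ)) :
    Integrable (fun x => f x * g x) area := by
  refine ((memLp_continuous_mul g f).integrable one_le_two).congr ?_
  filter_upwards with x
  exact mul_comm _ _

theorem integral_add_mul (f₁ f₂ : L2) (g : C(S2, ℂ)) :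
    ∫ x, (f₁ + f₂ : L2) x * g x ∂area
      = (∫ x, f₁ x * g x ∂area) + ∫ x, f₂ x * g x ∂area := by
  rw [← integral_add (integrable_mul_continuous f₁ g) (integrable_mul_continuous f₂ g)]
  refine integral_congr_ae ?_
  filter_upwards [Lp.coeFn_add f₁ f₂] with x hx
  rw [hx, Pi.add_apply, add_mul]

theorem integral_smul_mul (c : ℂ) (f : L2) (g : C(S2, ℂ)) :
    ∫ x, (c • f : L2) x * g x ∂area = c * ∫ x, f x * g x ∂area := by
  rw [← integral_const_mul]
  refine integral_congr_ae ?_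
  filter_upwards [Lp.coeFn_smul c f] with x hx
  rw [hx, Pi.smul_apply, smul_eq_mul, mul_assoc]

theorem integral_zero_mul (g : C(S2, ℂ)) : ∫ x, (0 : L2) x * g x ∂area = 0 := by
  simpa using integral_smul_mul 0 0 g

/-- `L²_b(S²)`: the functions in `L²(S²)` with `∫ f dS = 0`. -/
noncomputable def L2b : Submodule ℂ L2 where
  carrier := {f | ∫ x, f x ∂area = 0}
  add_mem' {f₁ f₂} h₁ h₂ := by
    have h := integral_add_mul f₁ f₂ 1
    simp only [ContinuousMap.one_apply, mul_one] at h
    simp only [Set.mem_ofPred_eq] at h₁ h₂ ⊢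
    rw [h, h₁, h₂, add_zero]
  zero_mem' := by
    have h := integral_zero_mul 1
    simp only [ContinuousMap.one_apply, mul_one] at h
    exact h
  smul_mem' c f hf := by
    have h := integral_smul_mul c f 1
    simp only [ContinuousMap.one_apply, mul_one] at h
    simp only [Set.mem_ofPred_eq] at hf ⊢
    rw [h, hf, mul_zero]

/- Smooth functions on `S²` are represented as the restrictions to `S²` of smooth functions
on `ℝ³`; both operators below depend only on the restriction. -/

/-- The rotation field `X₃ = x₁ ∂₂ - x₂ ∂₁ = ∂_ψ`, tangent to `S²`, applied to the
restriction of `Φ` to `S²`. -/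
noncomputable def X3 (Φ : E3 → ℂ) (x : S2) : ℂ :=
  fderiv ℝ Φ x (WithLp.toLp 2 ![-(x : E3) 1, (x : E3) 0, 0])

/-- The Laplace-Beltrami operator of `S²`, applied to the restriction of `Φ` to `S²`: the
Laplacian of the radially constant extension `y ↦ Φ (y / |y|)`, evaluated on `S²`. -/
noncomputable def sphereLaplacian (Φ : E3 → ℂ) (x : S2) : ℂ :=
  Laplacian.laplacian (fun y : E3 => Φ (‖y‖⁻¹ • y)) (x : E3)

theorem continuous_X3 {Φ : E3 → ℂ} (hΦ : ContDiff ℝ ∞ Φ) : Continuous (X3 Φ) := by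
  have h1 : Continuous (fderiv ℝ Φ) := hΦ.continuous_fderiv (by simp)
  have h2 : Continuous fun x : S2 =>
      (WithLp.toLp 2 ![-(x : E3) 1, (x : E3) 0, 0] : E3) := by
    refine (PiLp.continuous_toLp 2 _).comp (continuous_pi fun i => ?_)
    fin_cases i <;> simp <;> fun_prop
  exact (h1.comp continuous_subtype_val).clm_apply h2

/-- `V_k = {f ∈ L²_b(S²) : X₃ f = i k f}`, where `X₃ f = i k f` is meant in the sense of
distributions: `X₃` is divergence free, so its formal transpose is `-X₃`. -/
noncomputable def V (k : ℤ) : Submodule ℂ L2 where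
  carrier := {f | f ∈ L2b ∧ ∀ Φ : E3 → ℂ, ContDiff ℝ ∞ Φ →
    -∫ x, f x * X3 Φ x ∂area = Complex.I * k * ∫ x, f x * Φ x ∂area}
  add_mem' {f₁ f₂} h₁ h₂ := by
    refine ⟨L2b.add_mem h₁.1 h₂.1, fun Φ hΦ => ?_⟩
    have e₁ := integral_add_mul f₁ f₂ ⟨X3 Φ, continuous_X3 hΦ⟩
    have e₂ := integral_add_mul f₁ f₂
      ⟨fun x : S2 => Φ x, hΦ.continuous.comp continuous_subtype_val⟩
    simp only [ContinuousMap.coe_mk] at e₁ e₂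
    rw [e₁, e₂, mul_add, ← h₁.2 Φ hΦ, ← h₂.2 Φ hΦ, neg_add]
  zero_mem' := by
    refine ⟨L2b.zero_mem, fun Φ hΦ => ?_⟩
    have e₁ := integral_zero_mul ⟨X3 Φ, continuous_X3 hΦ⟩
    have e₂ := integral_zero_mul
      ⟨fun x : S2 => Φ x, hΦ.continuous.comp continuous_subtype_val⟩
    simp only [ContinuousMap.coe_mk] at e₁ e₂
    rw [e₁, e₂, mul_zero, neg_zero]
  smul_mem' c f hf := by
    refine ⟨L2b.smul_mem c hf.1, fun Φ hΦ => ?_⟩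
    have e₁ := integral_smul_mul c f ⟨X3 Φ, continuous_X3 hΦ⟩
    have e₂ := integral_smul_mul c f
      ⟨fun x : S2 => Φ x, hΦ.continuous.comp continuous_subtype_val⟩
    simp only [ContinuousMap.coe_mk] at e₁ e₂
    rw [e₁, e₂, mul_left_comm, ← hf.2 Φ hΦ, mul_neg]

/-- `Δ η = ζ` on `S²` in the sense of distributions. -/
def IsWeakLaplacian (η ζ : L2) : Prop :=
  ∀ Φ : E3 → ℂ, ContDiff ℝ ∞ Φ →
    ∫ x, η x * sphereLaplacian Φ x ∂area = ∫ x, ζ x * Φ x ∂area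

open Classical in
/-- `Δ⁻¹ ζ`: the solution `η ∈ L²_b(S²)` of `Δ η = ζ` (and `0` if there is none). -/
noncomputable def invLaplacian (ζ : L2) : L2 :=
  if h : ∃ η : L2, η ∈ L2b ∧ IsWeakLaplacian η ζ then h.choose else 0

/-- The function `x ↦ a(x₃)` on `S²`. -/
noncomputable def zonal (a : C(ℝ, ℝ)) : C(S2, ℂ) where
  toFun x := (a ((x : E3) 2) : ℂ)
  continuous_toFun := by fun_prop

/-- Multiplication of a function in `L²(S²)` by `a(x₃)`. -/
noncomputable def mulZonal (a : C(ℝ, ℝ)) (f : L2) : L2 :=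
  (memLp_continuous_mul (zonal a) f).toLp (fun x => zonal a x * f x)

/-- The operator `M ζ = A(x₃) ζ + B(x₃) Δ⁻¹ ζ`. -/
noncomputable def M (A B : C(ℝ, ℝ)) (ζ : L2) : L2 :=
  mulZonal A ζ + mulZonal B (invLaplacian ζ)

/-- `A(x₃) = x₃`. -/
def A₂ : C(ℝ, ℝ) := ⟨fun s => s, continuous_id⟩

/-- `B(x₃) = Ω + 6 x₃`. -/
noncomputable def B₂ (Ω : ℝ) : C(ℝ, ℝ) := ⟨fun s => Ω + 6 * s, by fun_prop⟩

/-- The Legendre polynomial `P_ℓ(s) = (2^ℓ ℓ!)⁻¹ (d/ds)^ℓ (s² - 1)^ℓ`. -/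
noncomputable def legendre (ℓ : ℕ) : ℝ[X] :=
  C (1 / (2 ^ ℓ * (ℓ.factorial : ℝ))) * derivative^[ℓ] ((X ^ 2 - 1) ^ ℓ)

/-- The function
`ζ_ℓ = √((2ℓ+1) / (2ℓ(ℓ+1))) e^{iψ} (1 - x₃²)^{1/2} P_ℓ'(x₃)` on `S²`, for `ℓ ≥ 1`,
where `e^{iψ} (1 - x₃²)^{1/2} = x₁ + i x₂`. -/
noncomputable def zetaFun (ℓ : ℕ) : C(S2, ℂ) where
  toFun x := (Real.sqrt ((2 * ℓ + 1) / (2 * ℓ * (ℓ + 1))) : ℂ)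
    * (((x : E3) 0 : ℂ) + Complex.I * ((x : E3) 1 : ℂ))
    * (((derivative (legendre ℓ)).eval ((x : E3) 2) : ℝ) : ℂ)
  continuous_toFun := by fun_prop

/-- `ζ_ℓ` as an element of `L²(S²)`. -/
noncomputable def zeta (ℓ : ℕ) : L2 := ContinuousMap.toLp 2 area ℂ (zetaFun ℓ)

/-- `V₁₂`, the closed linear span of `{ζ_ℓ : ℓ ≥ 2}`. -/
noncomputable def V12 : Submodule ℂ L2 :=
  (Submodule.span ℂ {f | ∃ ℓ : ℕ, 2 ≤ ℓ ∧ f = zeta ℓ}).topologicalClosure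

/-- The group `e^{itT}` generated by a bounded operator `T`, with the exponential series in the
Banach algebra of bounded operators. -/
noncomputable def expGroup {H : Type*} [NormedAddCommGroup H] [NormedSpace ℂ H]
    (T : H →L[ℂ] H) (t : ℝ) : H →L[ℂ] H :=
  NormedSpace.exp ((Complex.I * (t : ℂ)) • T)

end ZonalFlow

/-! The normalized `zeta ℓ`, `ℓ ≥ 1`, form a Hilbert basis of `V 1` on which `Δ⁻¹` is diagonal with
entries `-1/(ℓ(ℓ+1))`. Since `Ω = 0`, `M₁ = S D` with `S` multiplication by `x₃`, which is
self-adjoint, and `D = I + 6Δ⁻¹`, which is diagonal with entries `1 - 6/(ℓ(ℓ+1))`: this is `-2` at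
`ℓ = 1`, `0` at `ℓ = 2` and positive afterwards.

Everything rests on `x₃ ζ₁ = ζ₂/√5` together with `D ζ₂ = 0`. By symmetry `⟪ζ₁, S D f⟫ = ⟪D S ζ₁, f⟫
= 0`, so the range of `M₁` avoids the only negative direction of `D` (`inner_zeta_one_M₁`). The
nonzero spectrum of `S D` is then that of a self-adjoint operator `R S R`, where `R` is the square
root of the nonnegative part of `D` (`im_eq_zero_of_mem_spectrum_mul_diagOp`). The same relations
give `M₁ ζ₁ = -(2/√5) ζ₂` and `M₁ ζ₂ = 0`, a Jordan block at `0`, hence linear growth of `e^{itM₁}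
ζ₁`.

The analytic input is self-contained. The spherical Laplacian is half the sum of the squared
rotation fields over ordered index pairs, which makes it symmetric (`integral_mul_sphereLaplacian`).
Density of polynomials gives uniqueness for the Poisson equation (`eq_zero_of_isWeakLaplacian_zero`)
and, after sorting polynomials by rotation weight, completeness of the `zeta ℓ` in `V 1`
(`eq_zero_of_inner_zeta`). -/

namespace ZonalFlow

/-! ### Rotation invariance of the area and integration by parts -/

/-- A linear isometry of `ℝ³` acting on the sphere. -/
noncomputable def sphereMap (R : E3 ≃ₗᵢ[ℝ] E3) (x : S2) : S2 := ⟨R x, by simp⟩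

theorem continuous_sphereMap (R : E3 ≃ₗᵢ[ℝ] E3) : Continuous (sphereMap R) :=
  (R.continuous.comp continuous_subtype_val).subtype_mk _

-- The area of `s` is a multiple of the volume of the cone over `s`, and a linear isometry carries
-- cones to cones while preserving volume.
open scoped Pointwise in
theorem measurePreserving_sphereMap (R : E3 ≃ₗᵢ[ℝ] E3) :
    MeasurePreserving (sphereMap R) area area := by
  refine ⟨(continuous_sphereMap R).measurable, ?_⟩
  ext s hs
  have hs' := (continuous_sphereMap R).measurable hs
  rw [Measure.map_apply (continuous_sphereMap R).measurable hs, Measure.toSphere_apply' _ hs',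
    Measure.toSphere_apply' _ hs]
  congr 1
  have h : (Set.Ioo (0 : ℝ) 1 • ((↑) '' (sphereMap R ⁻¹' s) : Set E3))
      = R ⁻¹' (Set.Ioo (0 : ℝ) 1 • ((↑) '' s : Set E3)) := by
    ext y
    simp only [Set.mem_smul, Set.mem_image, Set.mem_preimage]
    constructor
    · rintro ⟨r, hr, _, ⟨x, hx, rfl⟩, rfl⟩
      exact ⟨r, hr, _, ⟨_, hx, rfl⟩, by simp [sphereMap]⟩
    · rintro ⟨r, hr, _, ⟨x, hx, rfl⟩, hy⟩
      refine ⟨r, hr, R.symm x, ⟨⟨R.symm x, by simp⟩, ?_, rfl⟩, ?_⟩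
      · simpa [sphereMap] using hx
      · apply R.injective
        simpa using hy
  rw [h]
  exact (show MeasurePreserving R.toHomeomorph.toMeasurableEquiv volume volume from
    R.measurePreserving).measure_preimage_equiv _

/-- The infinitesimal rotation `x ↦ xᵢ eⱼ - xⱼ eᵢ`. -/
noncomputable def rot (i j : Fin 3) : E3 →L[ℝ] E3 :=
  (EuclideanSpace.proj (𝕜 := ℝ) i : E3 →L[ℝ] ℝ).smulRight (EuclideanSpace.single j (1 : ℝ))
    - (EuclideanSpace.proj (𝕜 := ℝ) j : E3 →L[ℝ] ℝ).smulRight (EuclideanSpace.single i (1 : ℝ))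

theorem rot_apply (i j : Fin 3) (x : E3) :
    rot i j x = x i • EuclideanSpace.single j (1 : ℝ) - x j • EuclideanSpace.single i (1 : ℝ) := by
  simp [rot]

theorem rot_mem_skewAdjoint (i j : Fin 3) : rot i j ∈ skewAdjoint (E3 →L[ℝ] E3) := by
  rw [skewAdjoint.mem_iff, ContinuousLinearMap.star_eq_adjoint]
  symm
  rw [ContinuousLinearMap.eq_adjoint_iff]
  intro x y
  simp only [neg_apply, rot_apply, inner_neg_left, inner_sub_left,
    inner_sub_right, inner_smul_left, inner_smul_right, EuclideanSpace.inner_single_left,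
    EuclideanSpace.inner_single_right]
  simp
  ring

/-- The derivative of `F` along the field `x ↦ xᵢ ∂ⱼ - xⱼ ∂ᵢ`. -/
noncomputable def rotDeriv (i j : Fin 3) (F : E3 → ℂ) (x : E3) : ℂ := fderiv ℝ F x (rot i j x)

theorem contDiff_rotDeriv (i j : Fin 3) {F : E3 → ℂ} (hF : ContDiff ℝ ∞ F) :
    ContDiff ℝ ∞ (rotDeriv i j F) :=
  (hF.fderiv_right (m := ∞) (by simp)).clm_apply (rot i j).contDiff

theorem integrable_sphere {F : E3 → ℂ} (hF : Continuous F) :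
    Integrable (fun x : S2 => F x) area := by
  have h : Continuous fun x : S2 => F x := hF.comp continuous_subtype_val
  exact h.integrable_of_hasCompactSupport (HasCompactSupport.of_compactSpace _)

/-- The flow of a skew-adjoint field consists of isometries, so the integral of `F` along the flow
is constant in time; its derivative at time `0` is the integral on the left. Compactness of the
sphere supplies the dominating constant. -/
theorem integral_rotDeriv (i j : Fin 3) {F : E3 → ℂ} (hF : ContDiff ℝ ∞ F) :
    ∫ x : S2, rotDeriv i j F x ∂area = 0 := by
  let _ : NormedAlgebra ℚ (E3 →L[ℝ] E3) := NormedAlgebra.restrictScalars ℚ ℝ _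
  let U (t : ℝ) : E3 ≃ₗᵢ[ℝ] E3 := Unitary.linearIsometryEquiv
    ⟨NormedSpace.exp (t • rot i j), NormedSpace.exp_mem_unitary_of_mem_skewAdjoint
      (skewAdjoint.smul_mem t (rot_mem_skewAdjoint i j))⟩
  have hU (t : ℝ) (x : E3) : U t x = NormedSpace.exp (t • rot i j) x := rfl
  have hd (t : ℝ) (x : E3) : HasDerivAt (fun t => U t x) (rot i j (U t x)) t := by
    have h := hasDerivAt_exp_smul_const' (𝕂 := ℝ) (rot i j) t
    have h2 := h.clm_apply (hasDerivAt_const t x)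
    simpa [hU] using h2
  have hFd (t : ℝ) (x : E3) : HasDerivAt (fun t => F (U t x)) (rotDeriv i j F (U t x)) t :=
    ((hF.differentiable (by simp)) (U t x)).hasFDerivAt.comp_hasDerivAt t (hd t x)
  have hcont := (contDiff_rotDeriv i j hF).continuous
  obtain ⟨B, hB⟩ := (isCompact_sphere (0 : E3) 1).exists_bound_of_continuousOn hcont.continuousOn
  have hconst (t : ℝ) : ∫ x : S2, F (U t x) ∂area = ∫ x : S2, F x ∂area :=
    (measurePreserving_sphereMap (U t)).integral_comp'
      (f := ⟨⟨sphereMap (U t), sphereMap (U t).symm, fun x => by simp [sphereMap],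
        fun x => by simp [sphereMap]⟩, (continuous_sphereMap _).measurable,
        (continuous_sphereMap _).measurable⟩) (fun x : S2 => F x)
  have key := (hasDerivAt_integral_of_dominated_loc_of_deriv_le (μ := area) (𝕜 := ℝ)
    (F := fun t (x : S2) => F (U t x)) (F' := fun t (x : S2) => rotDeriv i j F (U t x))
    (x₀ := 0) (s := Set.univ) (bound := fun _ => B) Filter.univ_mem
    (Filter.Eventually.of_forall fun t =>
      (integrable_sphere (hF.continuous.comp (U t).continuous)).aestronglyMeasurable)
    (integrable_sphere (hF.continuous.comp (U 0).continuous))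
    (integrable_sphere (hcont.comp (U 0).continuous)).aestronglyMeasurable
    (Filter.Eventually.of_forall fun x t _ => hB _ (by simp))
    (integrable_const B)
    (Filter.Eventually.of_forall fun x t _ => hFd t x)).2
  simp only [hconst] at key
  have h0 := key.unique (hasDerivAt_const (0 : ℝ) _)
  simpa [hU, zero_smul ℝ (rot i j), NormedSpace.exp_zero] using h0

theorem rotDeriv_mul (i j : Fin 3) {F G : E3 → ℂ} (hF : ContDiff ℝ ∞ F) (hG : ContDiff ℝ ∞ G)
    (x : E3) : rotDeriv i j (fun y => F y * G y) x
      = F x * rotDeriv i j G x + rotDeriv i j F x * G x := by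
  have h := ((hF.differentiable (by simp) x).hasFDerivAt.mul
    (hG.differentiable (by simp) x).hasFDerivAt).fderiv
  simp only [rotDeriv]
  rw [show (fun y => F y * G y) = F * G from rfl, h]
  simp [mul_comm]

theorem integral_mul_rotDeriv (i j : Fin 3) {F G : E3 → ℂ} (hF : ContDiff ℝ ∞ F)
    (hG : ContDiff ℝ ∞ G) :
    ∫ x : S2, F x * rotDeriv i j G x ∂area = -∫ x : S2, rotDeriv i j F x * G x ∂area := by
  have h := integral_rotDeriv i j (hF.mul hG)
  simp only [rotDeriv_mul i j hF hG] at h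
  rw [integral_add] at h
  · exact eq_neg_of_add_eq_zero_left h
  · exact integrable_sphere (hF.continuous.mul (contDiff_rotDeriv i j hG).continuous)
  · exact integrable_sphere ((contDiff_rotDeriv i j hF).continuous.mul hG.continuous)

theorem X3_eq_rotDeriv (F : E3 → ℂ) (x : S2) : X3 F x = rotDeriv 0 1 F x := by
  rw [X3, rotDeriv, rot_apply]
  congr 1
  ext k
  fin_cases k <;> simp

/-! ### The spherical Laplacian through rotation fields -/

theorem hasDerivAt_normalize_line {x v : E3} {t : ℝ} (h : x + t • v ≠ 0) :
    HasDerivAt (fun t : ℝ => ‖x + t • v‖⁻¹ • (x + t • v))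
      (‖x + t • v‖⁻¹ • v
        + (-(⟪x + t • v, v⟫_ℝ / ‖x + t • v‖) / ‖x + t • v‖ ^ 2) • (x + t • v)) t ∧
    HasDerivAt (fun t : ℝ => ‖x + t • v‖) (⟪x + t • v, v⟫_ℝ / ‖x + t • v‖) t ∧
    HasDerivAt (fun t : ℝ => x + t • v) v t := by
  have hq : HasDerivAt (fun t : ℝ => x + t • v) v t := by
    simpa using ((hasDerivAt_id t).smul_const v).const_add x
  have hn0 : ‖x + t • v‖ ≠ 0 := norm_ne_zero_iff.2 h
  have hn : HasDerivAt (fun t : ℝ => ‖x + t • v‖) (⟪x + t • v, v⟫_ℝ / ‖x + t • v‖) t := by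
    have h2 := hq.norm_sq.sqrt (by positivity)
    simp only [Real.sqrt_sq (norm_nonneg _)] at h2
    convert h2 using 1
    field_simp
  exact ⟨(hn.inv hn0).smul hq, hn, hq⟩

theorem hasDerivAt_fderiv_line {f : E3 → ℂ} {x : E3} (hf : ContDiffAt ℝ 2 f x) (v : E3) :
    HasDerivAt (fun t : ℝ => fderiv ℝ f (x + t • v) v) (fderiv ℝ (fderiv ℝ f) x v v) 0 := by
  have hq : HasDerivAt (fun t : ℝ => x + t • v) v 0 := by
    simpa using ((hasDerivAt_id (0 : ℝ)).smul_const v).const_add x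
  have h1 : HasFDerivAt (fderiv ℝ f) (fderiv ℝ (fderiv ℝ f) x) (x + (0 : ℝ) • v) := by
    rw [zero_smul, add_zero]
    exact ((hf.fderiv_right (m := 1) (by norm_num)).differentiableAt (by simp)).hasFDerivAt
  have h2 := (HasFDerivAt.comp_hasDerivAt (f := fun t : ℝ => x + t • v) (0 : ℝ) h1 hq).clm_apply
    (hasDerivAt_const (0 : ℝ) v)
  simpa using h2

theorem hasDerivAt_normalize_velocity {x : E3} (hx : ‖x‖ = 1) (v : E3) :
    HasDerivAt (fun t : ℝ => ‖x + t • v‖⁻¹ • v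
        + (-(⟪x + t • v, v⟫_ℝ / ‖x + t • v‖) / ‖x + t • v‖ ^ 2) • (x + t • v))
      (-(2 * ⟪x, v⟫_ℝ) • v + (3 * ⟪x, v⟫_ℝ ^ 2 - ‖v‖ ^ 2) • x) 0 := by
  have hne0 : ‖x + (0 : ℝ) • v‖ ≠ 0 := by simp [hx]
  obtain ⟨-, hn, hq⟩ := hasDerivAt_normalize_line (norm_ne_zero_iff.1 hne0)
  have hi : HasDerivAt (fun t : ℝ => ⟪x + t • v, v⟫_ℝ) ⟪v, v⟫_ℝ 0 := by
    simpa using hq.inner ℝ (hasDerivAt_const (0 : ℝ) v)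
  have h := ((hn.inv hne0).smul_const v).add
    (((hi.div hn hne0).neg.div (hn.pow 2) (pow_ne_zero 2 hne0)).smul hq)
  refine h.congr_deriv ?_
  simp only [zero_smul, add_zero, hx, real_inner_self_eq_norm_sq, Pi.div_apply, Pi.neg_apply,
    Pi.pow_apply]
  module

theorem hasDerivAt_fderiv_comp {f : E3 → ℂ} (hf : ContDiff ℝ ∞ f) {c w : ℝ → E3} {c' w' : E3}
    {t : ℝ} (hc : HasDerivAt c c' t) (hw : HasDerivAt w w' t) :
    HasDerivAt (fun s => fderiv ℝ f (c s) (w s))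
      (fderiv ℝ (fderiv ℝ f) (c t) c' (w t) + fderiv ℝ f (c t) w') t := by
  have h : DifferentiableAt ℝ (fderiv ℝ f) (c t) :=
    ((hf.fderiv_right (m := ∞) (by simp)).differentiable (by simp)) _
  exact (h.hasFDerivAt.comp_hasDerivAt t hc).clm_apply hw

theorem contDiffAt_normalize {Φ : E3 → ℂ} (hΦ : ContDiff ℝ ∞ Φ) {y : E3} (hy : y ≠ 0) :
    ContDiffAt ℝ 2 (fun y : E3 => Φ (‖y‖⁻¹ • y)) y := by
  have h1 : ContDiffAt ℝ 2 (fun y : E3 => ‖y‖⁻¹ • y) y :=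
    ((contDiffAt_norm ℝ hy).inv (norm_ne_zero_iff.2 hy)).smul contDiffAt_id
  exact (hΦ.of_le (by norm_cast)).contDiffAt.comp y h1

/-- Both sides are the second derivative at `t = 0` of `Φ` along the normalized curve `(x + tv)/|x +
tv|`; the two vectors on the right are the velocity and acceleration of that curve. -/
theorem fderiv_fderiv_normalize {Φ : E3 → ℂ} (hΦ : ContDiff ℝ ∞ Φ) {x : E3} (hx : ‖x‖ = 1)
    (v : E3) :
    fderiv ℝ (fderiv ℝ fun y : E3 => Φ (‖y‖⁻¹ • y)) x v v
      = fderiv ℝ (fderiv ℝ Φ) x (v - ⟪x, v⟫_ℝ • x) (v - ⟪x, v⟫_ℝ • x)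
        + fderiv ℝ Φ x (-(2 * ⟪x, v⟫_ℝ) • v + (3 * ⟪x, v⟫_ℝ ^ 2 - ‖v‖ ^ 2) • x) := by
  have hx0 : x ≠ 0 := by
    rintro rfl
    simp at hx
  have hne : ∀ᶠ t : ℝ in nhds 0, x + t • v ≠ 0 := by
    have : ContinuousAt (fun t : ℝ => x + t • v) 0 := by fun_prop
    exact this.eventually_ne (by simpa using hx0)
  have hc0 := (hasDerivAt_normalize_line (x := x) (v := v) (t := 0) (by simpa using hx0)).1
  have hD1 := hasDerivAt_fderiv_line (contDiffAt_normalize hΦ hx0) v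
  have hD2 := hasDerivAt_fderiv_comp hΦ hc0 (hasDerivAt_normalize_velocity hx v)
  have heq : (fun t : ℝ => fderiv ℝ Φ (‖x + t • v‖⁻¹ • (x + t • v)) (‖x + t • v‖⁻¹ • v
        + (-(⟪x + t • v, v⟫_ℝ / ‖x + t • v‖) / ‖x + t • v‖ ^ 2) • (x + t • v)))
      =ᶠ[nhds 0] (fun t : ℝ => fderiv ℝ (fun y : E3 => Φ (‖y‖⁻¹ • y)) (x + t • v) v) := by
    filter_upwards [hne] with t ht
    obtain ⟨hc, -, hq⟩ := hasDerivAt_normalize_line ht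
    have h1 := (((contDiffAt_normalize hΦ ht).differentiableAt
      (by simp)).hasFDerivAt).comp_hasDerivAt t hq
    have h2 := (hΦ.differentiable (by simp) (‖x + t • v‖⁻¹ • (x + t • v))).hasFDerivAt.comp_hasDerivAt
      t hc
    exact h2.unique h1
  rw [(hD1.congr_of_eventuallyEq heq).unique hD2]
  have hw : (1 : ℝ)⁻¹ • v + (-(⟪x, v⟫_ℝ / 1) / 1 ^ 2) • x = v - ⟪x, v⟫_ℝ • x := by module
  have hz : (1 : ℝ)⁻¹ • x = x := by simp
  simp only [zero_smul, add_zero, hx, hw, hz]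

theorem sum_coord_smul_single (x : E3) :
    x = x 0 • EuclideanSpace.single 0 (1 : ℝ) + x 1 • EuclideanSpace.single 1 (1 : ℝ)
      + x 2 • EuclideanSpace.single 2 (1 : ℝ) := by
  ext k
  fin_cases k <;> simp

theorem clm_eq_sum_coord (A : E3 →L[ℝ] ℂ) (x : E3) :
    A x = x 0 * A (EuclideanSpace.single 0 1) + x 1 * A (EuclideanSpace.single 1 1)
      + x 2 * A (EuclideanSpace.single 2 1) := by
  conv_lhs => rw [sum_coord_smul_single x]
  simp only [map_add, map_smul, Complex.real_smul]

theorem sum_coord_sq {x : E3} (hx : ‖x‖ = 1) :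
    (x 0 : ℂ) ^ 2 + (x 1 : ℂ) ^ 2 + (x 2 : ℂ) ^ 2 = 1 := by
  have := EuclideanSpace.norm_sq_eq x
  have h : x 0 ^ 2 + x 1 ^ 2 + x 2 ^ 2 = 1 := by
    simpa [hx, Fin.sum_univ_three] using this.symm
  rw [← Complex.ofReal_one, ← h]
  push_cast
  rfl

theorem sum_bilin_sub (B : E3 →L[ℝ] E3 →L[ℝ] ℂ) (A : E3 →L[ℝ] ℂ) {x : E3} (hx : ‖x‖ = 1) :
    ∑ i, (B (EuclideanSpace.single i 1 - x i • x) (EuclideanSpace.single i 1 - x i • x)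
        + A (-(2 * x i) • EuclideanSpace.single i 1 + (3 * x i ^ 2 - 1) • x))
      = ∑ i, B (EuclideanSpace.single i 1) (EuclideanSpace.single i 1) - B x x - 2 * A x := by
  have h1 := clm_eq_sum_coord (B.flip x) x
  have h2 := clm_eq_sum_coord (B x) x
  have h3 := clm_eq_sum_coord A x
  simp only [ContinuousLinearMap.flip_apply] at h1
  simp only [Fin.sum_univ_three, map_add, map_sub, map_smul, sub_apply, smul_apply,
    Complex.real_smul]
  push_cast
  linear_combination h1 + h2 + 2 * h3 + (B x x + 3 * A x) * sum_coord_sq hx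

/-- To be read with `B` the Hessian and `A` the gradient of a function. The sum runs over ordered
pairs, so each rotation plane counts twice; hence the factor `2`. -/
theorem sum_rot_rot (B : E3 →L[ℝ] E3 →L[ℝ] ℂ) (A : E3 →L[ℝ] ℂ) {x : E3} (hx : ‖x‖ = 1) :
    ∑ i, ∑ j, (B (rot i j x) (rot i j x) + A (rot i j (rot i j x)))
      = 2 * (∑ i, B (EuclideanSpace.single i 1) (EuclideanSpace.single i 1) - B x x - 2 * A x) := by
  have h1 := clm_eq_sum_coord (B.flip x) x
  have h3 := clm_eq_sum_coord A x
  have h4 (i) := clm_eq_sum_coord (B (EuclideanSpace.single i 1)) x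
  simp only [ContinuousLinearMap.flip_apply] at h1
  simp only [Fin.sum_univ_three, rot_apply, map_sub, map_smul, sub_apply, smul_apply,
    Complex.real_smul, PiLp.single_apply]
  norm_num [show (0 : Fin 3) ≠ 2 by decide, show (1 : Fin 3) ≠ 2 by decide,
    show (2 : Fin 3) ≠ 0 by decide, show (2 : Fin 3) ≠ 1 by decide]
  linear_combination 2 * h1 + 2 * x 0 * h4 0 + 2 * x 1 * h4 1 + 2 * x 2 * h4 2 + 4 * h3
    + 2 * (B (EuclideanSpace.single 0 1) (EuclideanSpace.single 0 1)
      + B (EuclideanSpace.single 1 1) (EuclideanSpace.single 1 1)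
      + B (EuclideanSpace.single 2 1) (EuclideanSpace.single 2 1)) * sum_coord_sq hx

theorem sphereLaplacian_eq {Φ : E3 → ℂ} (hΦ : ContDiff ℝ ∞ Φ) (x : S2) :
    sphereLaplacian Φ x
      = ∑ i, fderiv ℝ (fderiv ℝ Φ) x (EuclideanSpace.single i 1) (EuclideanSpace.single i 1)
        - fderiv ℝ (fderiv ℝ Φ) x x x - 2 * fderiv ℝ Φ x x := by
  have hx : ‖(x : E3)‖ = 1 := by simp
  rw [← sum_bilin_sub _ _ hx, sphereLaplacian,
    InnerProductSpace.laplacian_eq_iteratedFDeriv_orthonormalBasis _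
      (EuclideanSpace.basisFun (Fin 3) ℝ)]
  refine Finset.sum_congr rfl fun i _ => ?_
  rw [iteratedFDeriv_two_apply]
  simp only [EuclideanSpace.basisFun_apply, Matrix.cons_val_zero, Matrix.cons_val_one]
  rw [fderiv_fderiv_normalize hΦ hx]
  simp [EuclideanSpace.inner_single_right]

theorem rotDeriv_rotDeriv (i j : Fin 3) {Φ : E3 → ℂ} (hΦ : ContDiff ℝ ∞ Φ) (x : E3) :
    rotDeriv i j (rotDeriv i j Φ) x
      = fderiv ℝ (fderiv ℝ Φ) x (rot i j x) (rot i j x) + fderiv ℝ Φ x (rot i j (rot i j x)) := by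
  have h1 : HasFDerivAt (fderiv ℝ Φ) (fderiv ℝ (fderiv ℝ Φ) x) x :=
    ((hΦ.fderiv_right (m := ∞) (by simp)).differentiable (by simp) x).hasFDerivAt
  have h2 := (h1.clm_apply (rot i j).hasFDerivAt).fderiv
  change fderiv ℝ (fun y => fderiv ℝ Φ y (rot i j y)) x (rot i j x) = _
  rw [h2]
  simp [add_comm]

theorem sum_rotDeriv_rotDeriv {Φ : E3 → ℂ} (hΦ : ContDiff ℝ ∞ Φ) (x : S2) :
    ∑ i, ∑ j, rotDeriv i j (rotDeriv i j Φ) x = 2 * sphereLaplacian Φ x := by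
  have hx : ‖(x : E3)‖ = 1 := by simp
  simp only [rotDeriv_rotDeriv _ _ hΦ, sphereLaplacian_eq hΦ, sum_rot_rot _ _ hx]

theorem continuous_sphereLaplacian {Φ : E3 → ℂ} (hΦ : ContDiff ℝ ∞ Φ) :
    Continuous (sphereLaplacian Φ) := by
  have h : sphereLaplacian Φ = fun x : S2 =>
      (1 / 2) * ∑ i, ∑ j, rotDeriv i j (rotDeriv i j Φ) x := by
    ext x
    rw [sum_rotDeriv_rotDeriv hΦ]
    ring
  rw [h]
  refine continuous_const.mul (continuous_finsetSum _ fun i _ => continuous_finsetSum _ fun j _ => ?_)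
  exact (contDiff_rotDeriv i j (contDiff_rotDeriv i j hΦ)).continuous.comp continuous_subtype_val

/-- The Laplace-Beltrami operator is symmetric on smooth functions. -/
theorem integral_mul_sphereLaplacian {F Φ : E3 → ℂ} (hF : ContDiff ℝ ∞ F) (hΦ : ContDiff ℝ ∞ Φ) :
    ∫ x : S2, F x * sphereLaplacian Φ x ∂area = ∫ x : S2, sphereLaplacian F x * Φ x ∂area := by
  have hint (i j : Fin 3) : ∫ x : S2, F x * rotDeriv i j (rotDeriv i j Φ) x ∂area
      = ∫ x : S2, rotDeriv i j (rotDeriv i j F) x * Φ x ∂area := by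
    rw [integral_mul_rotDeriv i j hF (contDiff_rotDeriv i j hΦ),
      integral_mul_rotDeriv i j (contDiff_rotDeriv i j hF) hΦ, neg_neg]
  have h1 : ∫ x : S2, F x * (2 * sphereLaplacian Φ x) ∂area
      = ∫ x : S2, (2 * sphereLaplacian F x) * Φ x ∂area := by
    simp only [← sum_rotDeriv_rotDeriv hΦ, ← sum_rotDeriv_rotDeriv hF, Finset.mul_sum,
      Finset.sum_mul]
    rw [integral_finsetSum, integral_finsetSum]
    · refine Finset.sum_congr rfl fun i _ => ?_
      rw [integral_finsetSum, integral_finsetSum]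
      · exact Finset.sum_congr rfl fun j _ => hint i j
      · exact fun j _ => integrable_sphere ((contDiff_rotDeriv i j
          (contDiff_rotDeriv i j hF)).continuous.mul hΦ.continuous)
      · exact fun j _ => integrable_sphere (hF.continuous.mul
          (contDiff_rotDeriv i j (contDiff_rotDeriv i j hΦ)).continuous)
    · exact fun i _ => integrable_finsetSum _ fun j _ => integrable_sphere ((contDiff_rotDeriv i j
          (contDiff_rotDeriv i j hF)).continuous.mul hΦ.continuous)
    · exact fun i _ => integrable_finsetSum _ fun j _ => integrable_sphere (hF.continuous.mul
          (contDiff_rotDeriv i j (contDiff_rotDeriv i j hΦ)).continuous)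
  simp only [mul_left_comm _ (2 : ℂ), mul_assoc, integral_const_mul] at h1
  exact mul_left_cancel₀ two_ne_zero h1

/-! ### Polynomials on the sphere -/

/-- A complex polynomial in three variables as a function on `ℝ³`. -/
noncomputable def polyFun (p : MvPolynomial (Fin 3) ℂ) (x : E3) : ℂ :=
  MvPolynomial.eval (fun i => (x i : ℂ)) p

section polyFun
open MvPolynomial

theorem hasFDerivAt_polyFun (p : MvPolynomial (Fin 3) ℂ) (x : E3) :
    HasFDerivAt (polyFun p) (∑ i, polyFun (pderiv i p) x •
      (Complex.ofRealCLM ∘L (EuclideanSpace.proj (𝕜 := ℝ) i : E3 →L[ℝ] ℝ))) x := by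
  induction p using MvPolynomial.induction_on with
  | C a =>
    have : polyFun (MvPolynomial.C a) = fun _ : E3 => a := by
      ext; simp [polyFun]
    rw [this]
    refine (hasFDerivAt_const a x).congr_fderiv ?_
    ext v
    simp [polyFun]
  | add p q hp hq =>
    have : polyFun (p + q) = polyFun p + polyFun q := by
      ext; simp [polyFun]
    rw [this]
    refine (hp.add hq).congr_fderiv ?_
    simp only [map_add, ← Finset.sum_add_distrib, ← add_smul]
    simp [polyFun]
  | mul_X p n hp =>
    have : polyFun (p * MvPolynomial.X n) = polyFun p * fun x : E3 => (x n : ℂ) := by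
      ext; simp [polyFun]
    rw [this]
    have hX : HasFDerivAt (fun x : E3 => (x n : ℂ))
        (Complex.ofRealCLM ∘L (EuclideanSpace.proj (𝕜 := ℝ) n : E3 →L[ℝ] ℝ)) x :=
      (Complex.ofRealCLM ∘L (EuclideanSpace.proj (𝕜 := ℝ) n : E3 →L[ℝ] ℝ)).hasFDerivAt
    refine (hp.mul hX).congr_fderiv ?_
    ext v
    simp only [Derivation.leibniz, pderiv_X, polyFun]
    fin_cases n <;> simp [Fin.sum_univ_three, Pi.single_apply] <;> ring

theorem contDiff_polyFun (p : MvPolynomial (Fin 3) ℂ) : ContDiff ℝ ∞ (polyFun p) := by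
  induction p using MvPolynomial.induction_on with
  | C a =>
    have : polyFun (MvPolynomial.C a) = fun _ : E3 => a := by
      ext; simp [polyFun]
    rw [this]
    exact contDiff_const
  | add p q hp hq =>
    have : polyFun (p + q) = polyFun p + polyFun q := by
      ext; simp [polyFun]
    rw [this]
    exact hp.add hq
  | mul_X p n hp =>
    have : polyFun (p * MvPolynomial.X n) = polyFun p * fun x : E3 => (x n : ℂ) := by
      ext; simp [polyFun]
    rw [this]
    exact hp.mul
      (Complex.ofRealCLM ∘L (EuclideanSpace.proj (𝕜 := ℝ) n : E3 →L[ℝ] ℝ)).contDiff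

theorem fderiv_polyFun (p : MvPolynomial (Fin 3) ℂ) (x v : E3) :
    fderiv ℝ (polyFun p) x v = ∑ i, v i * polyFun (pderiv i p) x := by
  rw [(hasFDerivAt_polyFun p x).fderiv]
  simp [mul_comm]

theorem fderiv_fderiv_polyFun (p : MvPolynomial (Fin 3) ℂ) (x v w : E3) :
    fderiv ℝ (fderiv ℝ (polyFun p)) x v w
      = ∑ i, ∑ j, v i * w j * polyFun (pderiv i (pderiv j p)) x := by
  have h1 : HasFDerivAt (fderiv ℝ (polyFun p)) (fderiv ℝ (fderiv ℝ (polyFun p)) x) x :=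
    (((contDiff_polyFun p).fderiv_right (m := ∞) (by simp)).differentiable (by simp) x).hasFDerivAt
  have h2 := (h1.clm_apply (hasFDerivAt_const w x)).fderiv
  have h3 : (fun y => fderiv ℝ (polyFun p) y w)
      = polyFun (∑ j, MvPolynomial.C (w j : ℂ) * pderiv j p) := by
    ext y
    rw [fderiv_polyFun]
    simp [polyFun]
  have h4 := DFunLike.congr_fun h2 v
  rw [h3, fderiv_polyFun] at h4
  simp only [ContinuousLinearMap.comp_zero, zero_add, ContinuousLinearMap.flip_apply] at h4
  rw [← h4]
  refine Finset.sum_congr rfl fun i _ => ?_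
  simp [polyFun, Finset.mul_sum, mul_assoc]

theorem sphereLaplacian_polyFun (p : MvPolynomial (Fin 3) ℂ) (x : S2) :
    sphereLaplacian (polyFun p) x = ∑ i, polyFun (pderiv i (pderiv i p)) x
      - ∑ i, ∑ j, (x : E3) i * (x : E3) j * polyFun (pderiv i (pderiv j p)) x
      - 2 * ∑ i, (x : E3) i * polyFun (pderiv i p) x := by
  rw [sphereLaplacian_eq (contDiff_polyFun p)]
  simp only [fderiv_fderiv_polyFun, fderiv_polyFun]
  simp [Fin.sum_univ_three, PiLp.single_apply]

/-- Euler's identity for `p` and for its first partial derivatives turns the radial terms into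
`n(n-1)p + 2np = n(n+1)p`. -/
theorem sphereLaplacian_of_isHomogeneous {p : MvPolynomial (Fin 3) ℂ} {n : ℕ}
    (hp : p.IsHomogeneous n) (x : S2) :
    sphereLaplacian (polyFun p) x
      = polyFun (∑ i, pderiv i (pderiv i p)) x - (n * (n + 1) : ℕ) * polyFun p x := by
  have h1 := congrArg (fun q => polyFun q x) hp.sum_X_mul_pderiv
  have h2 (j : Fin 3) := congrArg (fun q => polyFun q x) (hp.pderiv (i := j)).sum_X_mul_pderiv
  simp only [polyFun, map_sum, map_mul, MvPolynomial.eval_X, nsmul_eq_mul, map_natCast] at h1 h2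
  rw [sphereLaplacian_polyFun]
  simp only [polyFun, map_sum]
  have h3 : ∑ i, ∑ j, ((x : E3) i : ℂ) * (x : E3) j
      * eval (fun i => ((x : E3) i : ℂ)) (pderiv i (pderiv j p))
      = (n - 1 : ℕ) * (n * eval (fun i => ((x : E3) i : ℂ)) p) := by
    rw [Finset.sum_comm, ← h1, Finset.mul_sum]
    refine Finset.sum_congr rfl fun j _ => ?_
    rw [mul_left_comm, ← h2 j, Finset.mul_sum]
    exact Finset.sum_congr rfl fun i _ => by ring
  rw [h3, h1]
  rcases n with _ | n
  · simp
  · push_cast [Nat.add_sub_cancel]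
    ring

end polyFun

/-! ### Density of polynomials and uniqueness for the Poisson equation -/

theorem inner_toLp_continuous (g : C(S2, ℂ)) (f : L2) :
    ⟪ContinuousMap.toLp 2 area ℂ g, f⟫_ℂ = ∫ x, f x * (starRingEnd ℂ) (g x) ∂area := by
  rw [L2.inner_def]
  refine integral_congr_ae ?_
  filter_upwards [ContinuousMap.coeFn_toLp (p := 2) (𝕜 := ℂ) area g] with x hx
  rw [hx, RCLike.inner_apply]

/-- The restrictions of polynomials to the sphere. -/
noncomputable def polySubalgebra : StarSubalgebra ℂ C(S2, ℂ) where
  carrier := {g | ∃ p, ∀ x : S2, g x = polyFun p x}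
  mul_mem' := by
    rintro g h ⟨p, hp⟩ ⟨q, hq⟩
    exact ⟨p * q, fun x => by simp [hp, hq, polyFun]⟩
  add_mem' := by
    rintro g h ⟨p, hp⟩ ⟨q, hq⟩
    exact ⟨p + q, fun x => by simp [hp, hq, polyFun]⟩
  algebraMap_mem' c := ⟨MvPolynomial.C c, fun x => by simp [polyFun]⟩
  star_mem' := by
    rintro g ⟨p, hp⟩
    refine ⟨MvPolynomial.map (starRingEnd ℂ) p, fun x => ?_⟩
    simp only [ContinuousMap.star_apply, hp, polyFun, MvPolynomial.eval_map]
    rw [RCLike.star_def, MvPolynomial.eval, MvPolynomial.coe_eval₂Hom, MvPolynomial.eval₂_comp_left]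
    congr 1
    ext i
    simp

theorem polySubalgebra_separatesPoints : polySubalgebra.SeparatesPoints := by
  intro x y hxy
  by_contra! H
  refine hxy (Subtype.ext ?_)
  ext i
  have := H (fun x : S2 => ((x : E3) i : ℂ))
    ⟨⟨fun x : S2 => ((x : E3) i : ℂ), by fun_prop⟩, ⟨MvPolynomial.X i, fun x => by simp [polyFun]⟩, rfl⟩
  exact_mod_cast this

/-- A square integrable function orthogonal to all polynomials vanishes. -/
theorem eq_zero_of_integral_polyFun {f : L2} (h : ∀ p, ∫ x, f x * polyFun p x ∂area = 0) :
    f = 0 := by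
  have htop := ContinuousMap.starSubalgebra_topologicalClosure_eq_top_of_separatesPoints
    polySubalgebra polySubalgebra_separatesPoints
  have hall (g : C(S2, ℂ)) : ⟪ContinuousMap.toLp 2 area ℂ g, f⟫_ℂ = 0 := by
    have hg : g ∈ closure (polySubalgebra : Set C(S2, ℂ)) := by
      rw [← StarSubalgebra.topologicalClosure_coe, htop]
      trivial
    have hcl : IsClosed {g : C(S2, ℂ) | ⟪ContinuousMap.toLp 2 area ℂ g, f⟫_ℂ = 0} :=
      isClosed_eq (by fun_prop) continuous_const
    refine hcl.closure_subset_iff.2 ?_ hg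
    intro g hg
    -- The inner product conjugates `g`, so the hypothesis is applied to a polynomial representing
    -- the conjugate.
    obtain ⟨p, hp⟩ := polySubalgebra.star_mem' hg
    rw [Set.mem_ofPred_eq, inner_toLp_continuous, ← h p]
    refine integral_congr_ae (Filter.Eventually.of_forall fun x => ?_)
    simp [← hp]
  exact (ContinuousMap.toLp_denseRange ℂ area ℂ (p := 2) (by simp)).eq_zero_of_inner_right
    (𝕜 := ℂ) hall

/-- Uniqueness for the weak Poisson equation in `L²_b(S²)`. -/
theorem eq_zero_of_isWeakLaplacian_zero {η : L2} (hη : η ∈ L2b) (h : IsWeakLaplacian η 0) :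
    η = 0 := by
  have hint (p) : Integrable (fun x => η x * polyFun p x) area :=
    integrable_mul_continuous η
      ⟨fun x : S2 => polyFun p x, (contDiff_polyFun p).continuous.comp continuous_subtype_val⟩
  -- For `p` homogeneous of degree `n > 0`, `Δp` on the sphere is `-n(n+1)p` plus a polynomial of
  -- lower degree. Testing the equation against `p` thus reduces its pairing to lower degree; degree
  -- `0` is the mean-zero condition.
  have hhom (n : ℕ) : ∀ p : MvPolynomial (Fin 3) ℂ, p.IsHomogeneous n →
      ∫ x, η x * polyFun p x ∂area = 0 := by
    induction n using Nat.strong_induction_on with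
    | _ n ih =>
      intro p hp
      rcases Nat.eq_zero_or_pos n with rfl | hn
      · rw [← MvPolynomial.totalDegree_zero_iff_isHomogeneous] at hp
        rw [MvPolynomial.totalDegree_eq_zero_iff_eq_C.1 hp]
        have h0 : ∫ x, η x ∂area = 0 := hη
        simp [polyFun, integral_mul_const, h0]
      · have h1 := h (polyFun p) (contDiff_polyFun p)
        have h0 := integral_zero_mul
          ⟨fun x : S2 => polyFun p x, (contDiff_polyFun p).continuous.comp continuous_subtype_val⟩
        simp only [ContinuousMap.coe_mk] at h0
        rw [h0] at h1
        have hq : (∑ i, MvPolynomial.pderiv i (MvPolynomial.pderiv i p)).IsHomogeneous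
            (n - 1 - 1) :=
          MvPolynomial.IsHomogeneous.sum _ _ _ fun i _ => hp.pderiv.pderiv
        have h2 := ih (n - 1 - 1) (by omega) _ hq
        simp only [sphereLaplacian_of_isHomogeneous hp, mul_sub] at h1
        rw [integral_sub (hint _) (by
          simpa only [mul_left_comm] using (hint p).const_mul ((n * (n + 1) : ℕ) : ℂ)), h2] at h1
        simp only [mul_left_comm (η _), integral_const_mul, zero_sub, neg_eq_zero,
          mul_eq_zero, Nat.cast_eq_zero] at h1
        rcases h1 with h1 | h1
        · omega
        · exact h1
  refine eq_zero_of_integral_polyFun fun p => ?_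
  rw [← MvPolynomial.sum_homogeneousComponent p]
  have hs (x : S2) : polyFun (∑ i ∈ Finset.range (p.totalDegree + 1),
      MvPolynomial.homogeneousComponent i p) x
      = ∑ i ∈ Finset.range (p.totalDegree + 1),
        polyFun (MvPolynomial.homogeneousComponent i p) x := by simp [polyFun]
  simp only [hs, Finset.mul_sum]
  rw [integral_finsetSum _ fun i _ => hint _]
  exact Finset.sum_eq_zero fun i _ => hhom i _ (MvPolynomial.homogeneousComponent_isHomogeneous i p)

/-! ### Legendre polynomials -/

theorem iterate_derivative_X_mul_succ (k : ℕ) (f : ℝ[X]) :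
    derivative^[k + 1] (X * f) = X * derivative^[k + 1] f + ((k : ℝ[X]) + 1) * derivative^[k] f := by
  induction k with
  | zero => simp [add_comm]
  | succ k ih =>
    rw [Function.iterate_succ_apply', ih]
    simp only [derivative_add, derivative_mul, derivative_X, derivative_natCast, derivative_one,
      ← Function.iterate_succ_apply' derivative]
    push_cast
    ring

theorem iterate_derivative_X_sq_sub_one_mul (k : ℕ) (f : ℝ[X]) :
    derivative^[k + 2] ((X ^ 2 - 1) * f) = (X ^ 2 - 1) * derivative^[k + 2] f
      + 2 * ((k : ℝ[X]) + 2) * X * derivative^[k + 1] f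
        + ((k : ℝ[X]) + 2) * ((k : ℝ[X]) + 1) * derivative^[k] f := by
  have h : (X ^ 2 - 1 : ℝ[X]) * f = X * (X * f) - f := by ring
  rw [h, iterate_map_sub, show k + 2 = (k + 1) + 1 from rfl, iterate_derivative_X_mul_succ,
    show k + 1 + 1 = (k + 1) + 1 from rfl, iterate_derivative_X_mul_succ (k + 1),
    iterate_derivative_X_mul_succ k]
  push_cast
  ring

/-- Legendre's equation, differentiated once. -/
theorem legendre_derivative_ode (ℓ : ℕ) :
    (1 - X ^ 2) * derivative (derivative (derivative (legendre ℓ)))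
        - 4 * X * derivative (derivative (legendre ℓ)) - 2 * derivative (legendre ℓ)
      = -(ℓ * (ℓ + 1) : ℝ[X]) * derivative (legendre ℓ) := by
  set u : ℝ[X] := (X ^ 2 - 1) ^ ℓ with hu
  have h1 : (X ^ 2 - 1) * derivative u = C (2 * ℓ : ℝ) * (X * u) := by
    rw [hu, derivative_pow]
    rcases ℓ with _ | ℓ
    · simp
    · simp only [Nat.add_sub_cancel, derivative_sub, derivative_X_pow, derivative_one, map_mul,
        map_natCast, map_ofNat]
      push_cast
      ring
  -- Differentiating the first-order equation of `u` `ℓ + 1` times would give Legendre's equation;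
  -- one more derivative gives the equation for `P_ℓ'`.
  have h2 := congrArg (derivative^[ℓ + 2]) h1
  rw [iterate_derivative_X_sq_sub_one_mul, iterate_derivative_C_mul,
    show ℓ + 2 = (ℓ + 1) + 1 from rfl, iterate_derivative_X_mul_succ] at h2
  simp only [← Function.iterate_succ_apply derivative] at h2
  simp only [Function.iterate_succ_apply' derivative, map_mul, map_natCast, map_ofNat] at h2
  push_cast at h2
  simp only [legendre, derivative_C_mul, ← hu]
  linear_combination (-C (1 / (2 ^ ℓ * (ℓ.factorial : ℝ)))) * h2

theorem natDegree_iterate_derivative_eq (k : ℕ) (p : ℝ[X]) :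
    (derivative^[k] p).natDegree = p.natDegree - k := by
  induction k with
  | zero => simp
  | succ k ih => rw [Function.iterate_succ_apply', natDegree_derivative, ih, Nat.sub_sub]

/-- The exact degree serves twice: it makes the profiles span all polynomials, and it shows that no
`zeta (ℓ + 1)` vanishes. -/
theorem degree_derivative_legendre (ℓ : ℕ) : (derivative (legendre (ℓ + 1))).degree = ℓ := by
  have h : (legendre (ℓ + 1)).natDegree = ℓ + 1 := by
    rw [legendre, natDegree_C_mul (by positivity), natDegree_iterate_derivative_eq, natDegree_pow]
    have : (X ^ 2 - 1 : ℝ[X]).natDegree = 2 := by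
      simpa using natDegree_X_pow_sub_C (R := ℝ) (n := 2) (r := 1)
    rw [this]
    omega
  rw [degree_derivative (by omega), h]
  simp

/-! ### The functions `ζ_ℓ`: eigenvalues, orthogonality, nonvanishing -/

/-- The polynomial `(x₁ + κ x₂) Q(x₃)`. -/
noncomputable def wavePoly (κ : ℂ) (Q : ℂ[X]) : MvPolynomial (Fin 3) ℂ :=
  (MvPolynomial.X 0 + MvPolynomial.C κ * MvPolynomial.X 1) * aeval (MvPolynomial.X 2) Q

theorem eval_aeval_X_two (Q : ℂ[X]) (v : Fin 3 → ℂ) :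
    MvPolynomial.eval v (aeval (MvPolynomial.X 2) Q) = Q.eval (v 2) := by
  have h := hom_eval₂ Q (algebraMap ℂ (MvPolynomial (Fin 3) ℂ)) (MvPolynomial.eval v)
    (MvPolynomial.X 2)
  rw [aeval_def, h, MvPolynomial.eval_X, eval]
  congr 1
  ext a
  simp

theorem polyFun_wavePoly (κ : ℂ) (Q : ℂ[X]) (x : E3) :
    polyFun (wavePoly κ Q) x = (x 0 + κ * x 1) * Q.eval (x 2 : ℂ) := by
  simp [polyFun, wavePoly, eval_aeval_X_two]

theorem pderiv_aeval_X_two (i : Fin 3) (Q : ℂ[X]) :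
    MvPolynomial.pderiv i (aeval (MvPolynomial.X 2) Q : MvPolynomial (Fin 3) ℂ)
      = aeval (MvPolynomial.X 2) (derivative Q) * MvPolynomial.pderiv i (MvPolynomial.X 2) := by
  rw [Derivation.map_aeval, smul_eq_mul]

/-- The linear factor is harmonic for every `κ` and independent of `x₃`, so `κ` is left free: `i`
gives the `ζ_ℓ` and `-i` their conjugates. -/
theorem sphereLaplacian_wavePoly (κ : ℂ) (Q : ℂ[X]) (x : S2) :
    sphereLaplacian (polyFun (wavePoly κ Q)) x
      = polyFun (wavePoly κ ((1 - X ^ 2) * derivative (derivative Q) - 4 * X * derivative Q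
          - 2 * Q)) x := by
  rw [sphereLaplacian_polyFun, polyFun_wavePoly]
  simp only [wavePoly, Fin.sum_univ_three, Derivation.leibniz, pderiv_aeval_X_two, map_add,
    MvPolynomial.pderiv_C, MvPolynomial.pderiv_X, smul_eq_mul, polyFun, Pi.single_apply,
    map_mul, eval_aeval_X_two, MvPolynomial.eval_X, MvPolynomial.eval_C]
  simp [show (2 : Fin 3) ≠ 0 by decide, show (2 : Fin 3) ≠ 1 by decide,
    show (0 : Fin 3) ≠ 2 by decide, show (1 : Fin 3) ≠ 2 by decide]
  ring

/-- The radial profile of `ζ_ℓ`. -/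
noncomputable def zetaProfile (ℓ : ℕ) : ℂ[X] :=
  C (Real.sqrt ((2 * ℓ + 1) / (2 * ℓ * (ℓ + 1))) : ℂ)
    * (derivative (legendre ℓ)).map (algebraMap ℝ ℂ)

theorem eval_map_ofReal (q : ℝ[X]) (s : ℝ) :
    (q.map (algebraMap ℝ ℂ)).eval (s : ℂ) = ((q.eval s : ℝ) : ℂ) := by
  rw [eval_map, ← Complex.coe_algebraMap, eval₂_at_apply]

theorem zetaFun_eq_polyFun (ℓ : ℕ) (x : S2) :
    zetaFun ℓ x = polyFun (wavePoly Complex.I (zetaProfile ℓ)) x := by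
  rw [polyFun_wavePoly, zetaProfile, eval_mul, eval_C, eval_map_ofReal]
  simp only [zetaFun, ContinuousMap.coe_mk]
  ring

theorem conj_zetaFun_eq_polyFun (ℓ : ℕ) (x : S2) :
    (starRingEnd ℂ) (zetaFun ℓ x) = polyFun (wavePoly (-Complex.I) (zetaProfile ℓ)) x := by
  rw [polyFun_wavePoly, zetaProfile, eval_mul, eval_C, eval_map_ofReal]
  simp only [zetaFun, ContinuousMap.coe_mk, map_mul, map_add, Complex.conj_ofReal, Complex.conj_I]
  ring

theorem sphereLaplacian_zetaProfile (κ : ℂ) (ℓ : ℕ) (x : S2) :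
    sphereLaplacian (polyFun (wavePoly κ (zetaProfile ℓ))) x
      = -(ℓ * (ℓ + 1) : ℂ) * polyFun (wavePoly κ (zetaProfile ℓ)) x := by
  have h := congrArg (Polynomial.map (algebraMap ℝ ℂ)) (legendre_derivative_ode ℓ)
  have h' : (1 - X ^ 2) * derivative (derivative (zetaProfile ℓ))
      - 4 * X * derivative (zetaProfile ℓ) - 2 * zetaProfile ℓ
      = -(ℓ * (ℓ + 1) : ℂ[X]) * zetaProfile ℓ := by
    simp only [zetaProfile, derivative_C_mul, ← derivative_map]
    simp only [Polynomial.map_sub, Polynomial.map_mul, Polynomial.map_neg, Polynomial.map_add,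
      Polynomial.map_pow, Polynomial.map_one, Polynomial.map_natCast, Polynomial.map_ofNat,
      Polynomial.map_X, derivative_map] at h ⊢
    linear_combination (C (Real.sqrt ((2 * ℓ + 1) / (2 * ℓ * (ℓ + 1))) : ℂ)) * h
  rw [sphereLaplacian_wavePoly, h']
  simp only [polyFun_wavePoly, eval_mul, eval_neg, eval_add, eval_natCast, eval_one]
  ring

theorem integral_zeta_mul (ℓ : ℕ) (g : S2 → ℂ) :
    ∫ x, zeta ℓ x * g x ∂area
      = ∫ x : S2, polyFun (wavePoly Complex.I (zetaProfile ℓ)) x * g x ∂area := by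
  refine integral_congr_ae ?_
  filter_upwards [ContinuousMap.coeFn_toLp (p := 2) (𝕜 := ℂ) area (zetaFun ℓ)] with x hx
  rw [zeta, hx, zetaFun_eq_polyFun]

theorem inner_zeta (ℓ : ℕ) (f : L2) :
    ⟪zeta ℓ, f⟫_ℂ = ∫ x, f x * polyFun (wavePoly (-Complex.I) (zetaProfile ℓ)) x ∂area := by
  rw [zeta, inner_toLp_continuous]
  simp only [conj_zetaFun_eq_polyFun]

/-- `Δ ζ_ℓ = -ℓ (ℓ + 1) ζ_ℓ`. -/
theorem isWeakLaplacian_zeta (ℓ : ℕ) : IsWeakLaplacian (zeta ℓ) (-(ℓ * (ℓ + 1) : ℂ) • zeta ℓ) := by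
  intro Φ hΦ
  have h := integral_smul_mul (-(ℓ * (ℓ + 1) : ℂ)) (zeta ℓ)
    ⟨fun x : S2 => Φ x, hΦ.continuous.comp continuous_subtype_val⟩
  simp only [ContinuousMap.coe_mk] at h
  rw [h, integral_zeta_mul, integral_zeta_mul, integral_mul_sphereLaplacian (contDiff_polyFun _) hΦ]
  simp only [sphereLaplacian_zetaProfile, mul_assoc, integral_const_mul]

/-- Eigenfunctions of a symmetric operator for the distinct eigenvalues `-ℓ(ℓ+1)` and `-m(m+1)`. -/
theorem inner_zeta_zeta {ℓ m : ℕ} (h : ℓ ≠ m) : ⟪zeta ℓ, zeta m⟫_ℂ = 0 := by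
  have h1 := integral_mul_sphereLaplacian
    (contDiff_polyFun (wavePoly Complex.I (zetaProfile m)))
    (contDiff_polyFun (wavePoly (-Complex.I) (zetaProfile ℓ)))
  simp only [sphereLaplacian_zetaProfile, mul_left_comm _ (-(ℓ * (ℓ + 1) : ℂ)), mul_assoc,
    integral_const_mul] at h1
  rw [inner_zeta, integral_zeta_mul]
  have h2 : ((m * (m + 1) : ℕ) : ℂ) - ((ℓ * (ℓ + 1) : ℕ) : ℂ) ≠ 0 := by
    refine sub_ne_zero.2 (Nat.cast_injective.ne fun h' => ?_)
    rcases lt_or_gt_of_ne h with h | h <;> nlinarith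
  refine (mul_eq_zero.1 (?_ : _ * _ = (0 : ℂ))).resolve_left h2
  push_cast
  linear_combination h1

theorem zetaFun_ne_zero (ℓ : ℕ) : zetaFun (ℓ + 1) ≠ 0 := by
  intro h
  have hroot : Set.Ioo (-1 : ℝ) 1 ⊆ {s | (derivative (legendre (ℓ + 1))).IsRoot s} := by
    intro s hs
    have hs' : 0 < 1 - s ^ 2 := by nlinarith [hs.1, hs.2]
    -- On this meridian the factor `x₁ + i x₂` is positive, so vanishing of the function forces `s`
    -- to be a root of `P'`; infinitely many roots contradict the degree.
    let x : S2 := ⟨!₂[Real.sqrt (1 - s ^ 2), 0, s], by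
      simp [EuclideanSpace.norm_eq, Fin.sum_univ_three, Real.sq_sqrt hs'.le]⟩
    have hx := DFunLike.congr_fun h x
    have hc : (Real.sqrt ((2 * ((ℓ + 1 : ℕ) : ℝ) + 1) / (2 * (ℓ + 1 : ℕ) * ((ℓ + 1 : ℕ) + 1)))) ≠ 0 :=
      (Real.sqrt_pos.2 (by positivity)).ne'
    have hr := (Real.sqrt_pos.2 hs').ne'
    simp only [zetaFun, ContinuousMap.coe_mk, ContinuousMap.zero_apply, mul_eq_zero,
      Complex.ofReal_eq_zero, hc, false_or] at hx
    rcases hx with hx | hx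
    · simp [x] at hx
      exact absurd hx hr
    · simpa [x] using hx
  have h0 := eq_zero_of_infinite_isRoot _ ((Set.Ioo_infinite (by norm_num)).mono hroot)
  have := degree_derivative_legendre ℓ
  simp [h0] at this

theorem zeta_ne_zero (ℓ : ℕ) : zeta (ℓ + 1) ≠ 0 := by
  intro h
  refine zetaFun_ne_zero ℓ (ContinuousMap.toLp_injective (p := 2) (𝕜 := ℂ) area ?_)
  rw [map_zero]
  exact h

/-! ### Rotation weights and completeness in `V₁` -/

/-- The derivation `x₁ ∂₂ - x₂ ∂₁` of polynomials. -/
noncomputable def rotDerivation : Derivation ℂ (MvPolynomial (Fin 3) ℂ) (MvPolynomial (Fin 3) ℂ) :=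
  (MvPolynomial.X 0 : MvPolynomial (Fin 3) ℂ) • MvPolynomial.pderiv 1
    - (MvPolynomial.X 1 : MvPolynomial (Fin 3) ℂ) • MvPolynomial.pderiv 0

theorem rotDerivation_apply (p : MvPolynomial (Fin 3) ℂ) :
    rotDerivation p = MvPolynomial.X 0 * MvPolynomial.pderiv 1 p
      - MvPolynomial.X 1 * MvPolynomial.pderiv 0 p := by
  simp [rotDerivation]

theorem rotDeriv_polyFun (p : MvPolynomial (Fin 3) ℂ) (x : E3) :
    rotDeriv 0 1 (polyFun p) x
      = polyFun (rotDerivation p) x := by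
  rw [rotDeriv, fderiv_polyFun, rot_apply, rotDerivation_apply]
  simp [Fin.sum_univ_three, polyFun, PiLp.single_apply]
  ring

theorem derivation_pow_of_eigen (D : Derivation ℂ (MvPolynomial (Fin 3) ℂ) (MvPolynomial (Fin 3) ℂ))
    {w : MvPolynomial (Fin 3) ℂ} {c : ℂ} (h : D w = c • w) (n : ℕ) :
    D (w ^ n) = (n * c) • w ^ n := by
  induction n with
  | zero => simp
  | succ n ih =>
    rw [pow_succ, Derivation.leibniz, ih, h]
    simp only [MvPolynomial.smul_eq_C_mul, smul_eq_mul, map_mul, map_natCast]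
    push_cast
    ring

/-- The polynomial `(x₁ + i x₂)^a (x₁ - i x₂)^b x₃^c`. -/
noncomputable def weightPoly (a b c : ℕ) : MvPolynomial (Fin 3) ℂ :=
  (MvPolynomial.X 0 + MvPolynomial.C Complex.I * MvPolynomial.X 1) ^ a
    * (MvPolynomial.X 0 + MvPolynomial.C (-Complex.I) * MvPolynomial.X 1) ^ b
    * MvPolynomial.X 2 ^ c

theorem rotDeriv_weightPoly (a b c : ℕ) (x : E3) :
    rotDeriv 0 1 (polyFun (weightPoly a b c)) x
      = Complex.I * (a - b) * polyFun (weightPoly a b c) x := by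
  rw [rotDeriv_polyFun]
  have hI : (MvPolynomial.C Complex.I : MvPolynomial (Fin 3) ℂ) * MvPolynomial.C Complex.I = -1 := by
    rw [← map_mul, Complex.I_mul_I]
    simp
  have h1 : rotDerivation (MvPolynomial.X 0 + MvPolynomial.C Complex.I * MvPolynomial.X 1)
      = Complex.I • (MvPolynomial.X 0 + MvPolynomial.C Complex.I * MvPolynomial.X 1) := by
    simp [rotDerivation_apply, MvPolynomial.pderiv_X, MvPolynomial.smul_eq_C_mul]
    linear_combination -MvPolynomial.X 1 * hI
  have h2 : rotDerivation (MvPolynomial.X 0 + MvPolynomial.C (-Complex.I) * MvPolynomial.X 1)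
      = (-Complex.I) • (MvPolynomial.X 0 + MvPolynomial.C (-Complex.I) * MvPolynomial.X 1) := by
    simp [rotDerivation_apply, MvPolynomial.pderiv_X, MvPolynomial.smul_eq_C_mul]
    linear_combination -MvPolynomial.X 1 * hI
  have h3 : rotDerivation (MvPolynomial.X 2) = (0 : ℂ) • MvPolynomial.X 2 := by
    simp [rotDerivation_apply, MvPolynomial.pderiv_X]
  have h : rotDerivation (weightPoly a b c) = (Complex.I * (a - b)) • weightPoly a b c := by
    rw [weightPoly, Derivation.leibniz, Derivation.leibniz, derivation_pow_of_eigen _ h1,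
      derivation_pow_of_eigen _ h2, derivation_pow_of_eigen _ h3]
    simp only [MvPolynomial.smul_eq_C_mul, smul_eq_mul, map_mul, map_natCast, map_neg, map_sub,
      map_zero]
    ring
  rw [h]
  simp [polyFun, MvPolynomial.smul_eq_C_mul]

theorem rotDeriv_wavePoly_I (Q : ℂ[X]) (x : E3) :
    rotDeriv 0 1 (polyFun (wavePoly Complex.I Q)) x
      = Complex.I * polyFun (wavePoly Complex.I Q) x := by
  rw [rotDeriv_polyFun, polyFun_wavePoly]
  simp only [rotDerivation_apply, wavePoly, polyFun]
  simp [MvPolynomial.pderiv_X, eval_aeval_X_two]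
  linear_combination (-(x 1 : ℂ) * Q.eval (x 2 : ℂ)) * Complex.I_mul_I

theorem zeta_mem_V (ℓ : ℕ) : zeta ℓ ∈ V 1 := by
  have hs := contDiff_polyFun (wavePoly Complex.I (zetaProfile ℓ))
  refine ⟨?_, fun Φ hΦ => ?_⟩
  -- The mean vanishes because `X₃ζ = iζ` and every `X₃`-derivative integrates to zero.
  · have h := integral_rotDeriv 0 1 hs
    simp only [rotDeriv_wavePoly_I, integral_const_mul, mul_eq_zero, Complex.I_ne_zero,
      false_or] at h
    have h2 := integral_zeta_mul ℓ 1
    simp only [Pi.one_apply, mul_one] at h2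
    exact h2.trans h
  · rw [integral_zeta_mul, integral_zeta_mul]
    simp only [X3_eq_rotDeriv]
    rw [integral_mul_rotDeriv 0 1 hs hΦ, neg_neg]
    simp only [rotDeriv_wavePoly_I, mul_assoc, integral_const_mul]
    simp

theorem integrable_mul_polyFun (f : L2) (p : MvPolynomial (Fin 3) ℂ) :
    Integrable (fun x => f x * polyFun p x) area :=
  integrable_mul_continuous f
    ⟨fun x : S2 => polyFun p x, (contDiff_polyFun p).continuous.comp continuous_subtype_val⟩

/-- Pairing with polynomials, as a linear functional. -/
noncomputable def polyPairing (f : L2) : MvPolynomial (Fin 3) ℂ →ₗ[ℂ] ℂ where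
  toFun p := ∫ x, f x * polyFun p x ∂area
  map_add' p q := by
    rw [← integral_add (integrable_mul_polyFun f p) (integrable_mul_polyFun f q)]
    simp [polyFun, mul_add]
  map_smul' c p := by
    rw [RingHom.id_apply, smul_eq_mul, ← integral_const_mul]
    simp [polyFun, MvPolynomial.smul_eq_C_mul, mul_left_comm]

/-- `wavePoly` as a linear map in the profile. -/
noncomputable def wavePolyₗ (κ : ℂ) : ℂ[X] →ₗ[ℂ] MvPolynomial (Fin 3) ℂ :=
  LinearMap.mulLeft ℂ (MvPolynomial.X 0 + MvPolynomial.C κ * MvPolynomial.X 1) ∘ₗ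
    (aeval (MvPolynomial.X 2)).toLinearMap

theorem degree_zetaProfile (ℓ : ℕ) : (zetaProfile (ℓ + 1)).degree = ℓ := by
  have hc : (Real.sqrt ((2 * ((ℓ + 1 : ℕ) : ℝ) + 1) / (2 * (ℓ + 1 : ℕ) * ((ℓ + 1 : ℕ) + 1))) : ℂ) ≠ 0 :=
    Complex.ofReal_ne_zero.2 (Real.sqrt_pos.2 (by positivity)).ne'
  rw [zetaProfile, degree_C_mul hc, degree_map, degree_derivative_legendre]

theorem span_zetaProfile : Submodule.span ℂ (Set.range fun ℓ => zetaProfile (ℓ + 1)) = ⊤ :=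
  let S : Polynomial.Sequence ℂ := ⟨fun ℓ => zetaProfile (ℓ + 1), degree_zetaProfile⟩
  S.span fun i => (leadingCoeff_ne_zero.2 (S.ne_zero i)).isUnit

/-- The functions `ζ_ℓ`, `ℓ ≥ 1`, are complete in `V₁`. -/
theorem eq_zero_of_inner_zeta {f : L2} (hf : f ∈ V 1) (h : ∀ ℓ, ⟪zeta (ℓ + 1), f⟫_ℂ = 0) :
    f = 0 := by
  have hwave (Q : ℂ[X]) : polyPairing f (wavePoly (-Complex.I) Q) = 0 := by
    have h0 : polyPairing f ∘ₗ wavePolyₗ (-Complex.I) = 0 := by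
      refine LinearMap.ext_on_range span_zetaProfile fun ℓ => ?_
      exact (inner_zeta _ _).symm.trans (h ℓ)
    exact LinearMap.congr_fun h0 Q
  -- Membership in `V 1` gives `(a - b + 1)` times the pairing equal to zero, so only `b = a + 1` is
  -- left. There `(x₁ + ix₂)(x₁ - ix₂) = 1 - x₃²` on the sphere reduces the weight polynomial to a
  -- `wavePoly` with `κ = -i`.
  have hweight (a b c : ℕ) : polyPairing f (weightPoly a b c) = 0 := by
    have h1 := hf.2 _ (contDiff_polyFun (weightPoly a b c))
    simp only [X3_eq_rotDeriv, rotDeriv_weightPoly, mul_left_comm (f _), integral_const_mul] at h1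
    change -(_ * polyPairing f (weightPoly a b c)) = _ * polyPairing f (weightPoly a b c) at h1
    by_cases hb : b = a + 1
    · subst hb
      rw [← hwave ((1 - X ^ 2) ^ a * X ^ c)]
      refine integral_congr_ae (Filter.Eventually.of_forall fun x => ?_)
      have hx := sum_coord_sq (x := (x : E3)) (by simp)
      have hx' : ((x : E3) 0 + Complex.I * (x : E3) 1 : ℂ) * ((x : E3) 0 + -Complex.I * (x : E3) 1)
          = 1 - (x : E3) 2 ^ 2 := by
        linear_combination hx - ((x : E3) 1 : ℂ) ^ 2 * Complex.I_mul_I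
      simp only [polyFun_wavePoly]
      simp only [weightPoly, polyFun, map_mul, map_pow, map_add, MvPolynomial.eval_X,
        MvPolynomial.eval_C, eval_mul, eval_pow, eval_sub, eval_one, eval_X]
      rw [← hx', mul_pow]
      ring
    · have hne : Complex.I * ((a : ℂ) - b + 1) ≠ 0 := by
        refine mul_ne_zero Complex.I_ne_zero fun h0 => hb ?_
        have : ((b : ℕ) : ℂ) = ((a + 1 : ℕ) : ℂ) := by
          push_cast
          linear_combination -h0
        exact_mod_cast this
      refine (mul_eq_zero.1 (?_ : _ * _ = (0 : ℂ))).resolve_left hne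
      push_cast at h1
      linear_combination -h1
  -- `T` substitutes `x₁ ± i x₂` for the first two variables and `T'` is a right inverse, so every
  -- polynomial is a combination of weight polynomials.
  let T : MvPolynomial (Fin 3) ℂ →ₐ[ℂ] MvPolynomial (Fin 3) ℂ := MvPolynomial.aeval
    ![MvPolynomial.X 0 + MvPolynomial.C Complex.I * MvPolynomial.X 1,
      MvPolynomial.X 0 + MvPolynomial.C (-Complex.I) * MvPolynomial.X 1, MvPolynomial.X 2]
  let T' : MvPolynomial (Fin 3) ℂ →ₐ[ℂ] MvPolynomial (Fin 3) ℂ := MvPolynomial.aeval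
    ![MvPolynomial.C (1 / 2) * (MvPolynomial.X 0 + MvPolynomial.X 1),
      MvPolynomial.C (-Complex.I / 2) * (MvPolynomial.X 0 - MvPolynomial.X 1), MvPolynomial.X 2]
  have hTT : T.comp T' = AlgHom.id ℂ _ := by
    have h2 : (MvPolynomial.C (1 / 2) : MvPolynomial (Fin 3) ℂ) * 2 = 1 := by
      rw [← map_ofNat MvPolynomial.C 2, ← map_mul]
      norm_num
    have h3 : (MvPolynomial.C (-Complex.I / 2) * MvPolynomial.C Complex.I :
        MvPolynomial (Fin 3) ℂ) * 2 = 1 := by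
      rw [← map_ofNat MvPolynomial.C 2, ← map_mul, ← map_mul, ← map_one MvPolynomial.C]
      congr 1
      linear_combination -Complex.I_mul_I
    refine MvPolynomial.algHom_ext fun i => ?_
    fin_cases i
    · simp only [T, T', AlgHom.comp_apply, Fin.zero_eta, MvPolynomial.aeval_X, Matrix.cons_val_zero,
        map_mul, map_add, Matrix.cons_val_one, MvPolynomial.algHom_C, MvPolynomial.algebraMap_eq,
        map_neg, AlgHom.id_apply]
      linear_combination MvPolynomial.X 0 * h2
    · simp only [T, T', AlgHom.comp_apply, Fin.mk_one, MvPolynomial.aeval_X, Matrix.cons_val_zero,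
        map_mul, map_sub, Matrix.cons_val_one, MvPolynomial.algHom_C, MvPolynomial.algebraMap_eq,
        map_neg, AlgHom.id_apply]
      linear_combination MvPolynomial.X 1 * h3
    · simp [T, T']
  refine eq_zero_of_integral_polyFun fun p => ?_
  change polyPairing f p = 0
  have hp : p = T (T' p) := (AlgHom.congr_fun hTT p).symm
  rw [hp]
  generalize T' p = q
  induction q using MvPolynomial.induction_on' with
  | monomial u c =>
    have : T (MvPolynomial.monomial u c) = c • weightPoly (u 0) (u 1) (u 2) := by
      simp only [T, MvPolynomial.aeval_monomial, weightPoly, MvPolynomial.algebraMap_eq,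
        MvPolynomial.smul_eq_C_mul]
      rw [Finsupp.prod_fintype _ _ (by simp), Fin.prod_univ_three]
      rfl
    rw [this, map_smul, hweight, smul_zero]
  | add q r hq hr => rw [map_add, map_add, hq, hr, add_zero]

/-! ### Diagonal operators and the spectrum of `S D` -/

section Diagonal

variable {ι H : Type*} [NormedAddCommGroup H] [InnerProductSpace ℂ H]

theorem memℓp_diag (b : HilbertBasis ι ℂ H) {d : ι → ℝ} (hd : ∃ C, ∀ i, |d i| ≤ C) (x : H) :
    Memℓp (fun i => (d i : ℂ) * b.repr x i) 2 := by
  obtain ⟨C, hC⟩ := hd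
  have h := (memℓp_gen_iff (by simp)).1 (lp.memℓp (b.repr x))
  refine memℓp_gen ((h.mul_left (C ^ 2)).of_nonneg_of_le (fun i => by positivity) fun i => ?_)
  simp only [ENNReal.toReal_ofNat, Real.rpow_two, norm_mul, mul_pow, Complex.norm_real,
    Real.norm_eq_abs]
  gcongr
  exact hC i

/-- The linear map that is diagonal in a Hilbert basis, with a bounded real diagonal. -/
noncomputable def diagLin (b : HilbertBasis ι ℂ H) (d : ι → ℝ) (hd : ∃ C, ∀ i, |d i| ≤ C) :
    H →ₗ[ℂ] H where
  toFun x := b.repr.symm ⟨fun i => (d i : ℂ) * b.repr x i, memℓp_diag b hd x⟩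
  map_add' x y := by
    rw [← map_add]
    congr 1
    ext i
    simp only [map_add, lp.coeFn_add, Pi.add_apply, mul_add]
  map_smul' c x := by
    rw [← map_smul]
    congr 1
    ext i
    simp [mul_left_comm]

theorem repr_diagLin (b : HilbertBasis ι ℂ H) (d : ι → ℝ) (hd : ∃ C, ∀ i, |d i| ≤ C) (x : H)
    (i : ι) : b.repr (diagLin b d hd x) i = d i * b.repr x i := by
  simp [diagLin]

theorem isSymmetric_diagLin (b : HilbertBasis ι ℂ H) (d : ι → ℝ) (hd : ∃ C, ∀ i, |d i| ≤ C) :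
    (diagLin b d hd).IsSymmetric := by
  intro x y
  rw [← b.tsum_inner_mul_inner, ← b.tsum_inner_mul_inner]
  refine tsum_congr fun i => ?_
  rw [← b.repr_apply_apply, ← b.repr_apply_apply, repr_diagLin, ← inner_conj_symm,
    ← b.repr_apply_apply, repr_diagLin, ← inner_conj_symm x, ← b.repr_apply_apply]
  simp only [map_mul, Complex.conj_ofReal]
  ring

theorem eq_of_repr_eq (b : HilbertBasis ι ℂ H) {x y : H} (h : ∀ i, b.repr x i = b.repr y i) :
    x = y :=
  b.repr.injective (lp.ext (funext h))

variable [CompleteSpace H]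

/-- The bounded operator that is diagonal in a Hilbert basis, with a bounded real diagonal. -/
noncomputable def diagOp (b : HilbertBasis ι ℂ H) (d : ι → ℝ) (hd : ∃ C, ∀ i, |d i| ≤ C) :
    H →L[ℂ] H :=
  -- Hellinger–Toeplitz: an everywhere defined symmetric operator on a Hilbert space is bounded.
  ⟨diagLin b d hd, (isSymmetric_diagLin b d hd).continuous⟩

theorem repr_diagOp (b : HilbertBasis ι ℂ H) (d : ι → ℝ) (hd : ∃ C, ∀ i, |d i| ≤ C) (x : H)
    (i : ι) : b.repr (diagOp b d hd x) i = d i * b.repr x i :=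
  repr_diagLin b d hd x i

theorem isSelfAdjoint_diagOp (b : HilbertBasis ι ℂ H) (d : ι → ℝ) (hd : ∃ C, ∀ i, |d i| ≤ C) :
    IsSelfAdjoint (diagOp b d hd) :=
  ContinuousLinearMap.isSelfAdjoint_iff_isSymmetric.2 (isSymmetric_diagLin b d hd)

theorem diagOp_basis (b : HilbertBasis ι ℂ H) (d : ι → ℝ) (hd : ∃ C, ∀ i, |d i| ≤ C) (i : ι) :
    diagOp b d hd (b i) = (d i : ℂ) • b i := by
  classical
  refine eq_of_repr_eq b fun j => ?_
  rw [repr_diagOp, map_smul, lp.coeFn_smul, Pi.smul_apply, smul_eq_mul]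
  rcases eq_or_ne i j with rfl | h
  · rfl
  · simp [b.repr_self, h.symm]

theorem re_inner_diagOp_nonneg (b : HilbertBasis ι ℂ H) (d : ι → ℝ) (hd : ∃ C, ∀ i, |d i| ≤ C)
    {x : H} (hx : ∀ i, 0 ≤ d i ∨ b.repr x i = 0) : 0 ≤ (⟪diagOp b d hd x, x⟫_ℂ).re := by
  have h := Complex.hasSum_re (b.hasSum_inner_mul_inner (diagOp b d hd x) x)
  refine h.nonneg fun i => ?_
  rw [← inner_conj_symm, ← b.repr_apply_apply, ← b.repr_apply_apply, repr_diagOp]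
  rcases hx i with hi | hi
  · rw [map_mul, Complex.conj_ofReal, mul_assoc, ← Complex.normSq_eq_conj_mul_self,
      ← Complex.ofReal_mul, Complex.ofReal_re]
    exact mul_nonneg hi (Complex.normSq_nonneg _)
  · simp [hi]

/-- A product `S D` of a self-adjoint operator and a diagonal operator with a single negative
entry has real spectrum if its range is orthogonal to the corresponding basis vector. -/
theorem im_eq_zero_of_mem_spectrum_mul_diagOp (b : HilbertBasis ι ℂ H) (d : ι → ℝ)
    (hd : ∃ C, ∀ i, |d i| ≤ C) (i₀ : ι) (hpos : ∀ i, i ≠ i₀ → 0 ≤ d i) {S : H →L[ℂ] H}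
    (hS : IsSelfAdjoint S) (hrange : ∀ x, b.repr (S (diagOp b d hd x)) i₀ = 0) {z : ℂ}
    (hz : z ∈ spectrum ℂ (S * diagOp b d hd)) : z.im = 0 := by
  classical
  have hp : ∃ C, ∀ i, |(if i = i₀ then 0 else 1 : ℝ)| ≤ C :=
    ⟨1, fun i => by split_ifs <;> simp⟩
  have hr : ∃ C, ∀ i, |(if i = i₀ then 0 else Real.sqrt (d i) : ℝ)| ≤ C := by
    obtain ⟨C, hC⟩ := hd
    refine ⟨Real.sqrt C, fun i => ?_⟩
    split_ifs
    · simp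
    · rw [abs_of_nonneg (Real.sqrt_nonneg _)]
      exact Real.sqrt_le_sqrt ((le_abs_self _).trans (hC i))
  -- `P` is the projection that kills coordinate `i₀`, and `R` is the square root of `D` with its
  -- entry at `i₀` replaced by `0`.
  set P := diagOp b _ hp with hP
  set R := diagOp b _ hr with hR
  set D := diagOp b d hd with hD
  have h1 : P * (S * D) = S * D := by
    ext x
    refine eq_of_repr_eq b fun i => ?_
    simp only [mul_apply_eq_comp, hP, repr_diagOp]
    split_ifs with h
    · rw [h, hrange, mul_zero]
    · simp
  have h2 : D * P = R * R := by
    ext x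
    refine eq_of_repr_eq b fun i => ?_
    simp only [mul_apply_eq_comp, hP, hR, hD, repr_diagOp]
    split_ifs with h
    · simp
    · rw [← mul_assoc, ← mul_assoc, ← Complex.ofReal_mul, ← Complex.ofReal_mul,
        Real.mul_self_sqrt (hpos i h), mul_one]
  by_contra him
  have hz0 : z ∉ ({0} : Set ℂ) := by
    rintro rfl
    simp at him
  have h3 : z ∈ spectrum ℂ (P * (S * D)) \ {0} := ⟨h1.symm ▸ hz, hz0⟩
  -- Away from `0` the spectra of `P S D`, `S D P = S R R` and `R S R` agree.
  rw [spectrum.nonzero_mul_comm, mul_assoc, h2, ← mul_assoc, spectrum.nonzero_mul_comm] at h3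
  have hsa : IsSelfAdjoint (R * (S * R)) := by
    have hRs : IsSelfAdjoint R := isSelfAdjoint_diagOp b _ hr
    rw [isSelfAdjoint_iff, star_mul, star_mul, hRs.star_eq, hS.star_eq, mul_assoc]
  exact him (hsa.im_eq_zero_of_mem_spectrum h3.1)

end Diagonal

theorem exp_apply_of_apply_apply_eq_zero {H : Type*} [NormedAddCommGroup H] [NormedSpace ℂ H]
    [CompleteSpace H] (A : H →L[ℂ] H) {x : H} (h : A (A x) = 0) :
    NormedSpace.exp A x = x + A x := by
  have h1 := (NormedSpace.exp_series_hasSum_exp' (𝕂 := ℂ) A).mapL (ContinuousLinearMap.apply ℂ H x)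
  have h2 := hasSum_sum_of_ne_finset_zero (L := SummationFilter.unconditional ℕ) (s := Finset.range 2)
    (f := fun n => ContinuousLinearMap.apply ℂ H x ((n.factorial⁻¹ : ℂ) • A ^ n)) fun n hn => by
      obtain ⟨m, rfl⟩ : ∃ m, n = m + 2 := ⟨n - 2, by simp at hn; omega⟩
      simp [pow_add, pow_two, h]
  simpa [Finset.sum_range_succ] using h1.unique h2

/-! ### The Hilbert basis of `V₁` and the inverse Laplacian -/

/-- Integration against a continuous function, as a bounded functional on `L²(S²)`. -/
noncomputable def pairing (g : C(S2, ℂ)) : L2 →L[ℂ] ℂ :=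
  innerSL ℂ (ContinuousMap.toLp 2 area ℂ (star g))

theorem pairing_apply (g : C(S2, ℂ)) (f : L2) : pairing g f = ∫ x, f x * g x ∂area := by
  rw [pairing, innerSL_apply_apply, inner_toLp_continuous]
  simp

/-- The restriction of a smooth function to the sphere. -/
noncomputable def restrictSphere {Φ : E3 → ℂ} (hΦ : ContDiff ℝ ∞ Φ) : C(S2, ℂ) :=
  ⟨fun x => Φ x, hΦ.continuous.comp continuous_subtype_val⟩

theorem isClosed_V_one : IsClosed (V 1 : Set L2) := by
  have h : (V 1 : Set L2) = {f | pairing 1 f = 0} ∩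
      ⋂ (Φ : E3 → ℂ) (hΦ : ContDiff ℝ ∞ Φ), {f | -pairing ⟨X3 Φ, continuous_X3 hΦ⟩ f
        = Complex.I * (1 : ℤ) * pairing (restrictSphere hΦ) f} := by
    ext f
    simp only [Set.mem_inter_iff, Set.mem_iInter, Set.mem_ofPred_eq, pairing_apply,
      restrictSphere, ContinuousMap.coe_mk, ContinuousMap.one_apply, mul_one]
    rfl
  rw [h]
  refine (isClosed_eq (by fun_prop) continuous_const).inter ?_
  exact isClosed_iInter fun Φ => isClosed_iInter fun hΦ => isClosed_eq (by fun_prop) (by fun_prop)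

instance completeSpace_V_one : CompleteSpace (V 1) := isClosed_V_one.completeSpace_coe

/-- The normalized function `ζ_{ℓ+1}` in `V₁`. -/
noncomputable def unitZeta (ℓ : ℕ) : V 1 :=
  ((‖zeta (ℓ + 1)‖⁻¹ : ℝ) : ℂ) • ⟨zeta (ℓ + 1), zeta_mem_V _⟩

theorem coe_unitZeta (ℓ : ℕ) :
    (unitZeta ℓ : L2) = ((‖zeta (ℓ + 1)‖⁻¹ : ℝ) : ℂ) • zeta (ℓ + 1) := rfl

theorem zeta_eq_smul_unitZeta (ℓ : ℕ) :
    (⟨zeta (ℓ + 1), zeta_mem_V _⟩ : V 1) = (‖zeta (ℓ + 1)‖ : ℂ) • unitZeta ℓ := by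
  rw [unitZeta, smul_smul, ← Complex.ofReal_mul,
    mul_inv_cancel₀ (norm_ne_zero_iff.2 (zeta_ne_zero ℓ)), Complex.ofReal_one, one_smul]

theorem orthonormal_unitZeta : Orthonormal ℂ unitZeta := by
  refine ⟨fun ℓ => ?_, fun ℓ m h => ?_⟩
  · change ‖(unitZeta ℓ : L2)‖ = 1
    rw [coe_unitZeta, norm_smul, Complex.norm_real, norm_inv, norm_norm,
      inv_mul_cancel₀ (norm_ne_zero_iff.2 (zeta_ne_zero ℓ))]
  · change ⟪(unitZeta ℓ : L2), (unitZeta m : L2)⟫_ℂ = 0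
    rw [coe_unitZeta, coe_unitZeta, inner_smul_left,
      inner_smul_right, inner_zeta_zeta (by omega), mul_zero, mul_zero]

/-- The Hilbert basis of `V₁` consisting of the normalized functions `ζ_ℓ`. -/
noncomputable def zetaBasis : HilbertBasis ℕ ℂ (V 1) :=
  HilbertBasis.mkOfOrthogonalEqBot orthonormal_unitZeta <| by
    rw [Submodule.eq_bot_iff]
    intro f hf
    have h (ℓ : ℕ) : ⟪zeta (ℓ + 1), (f : L2)⟫_ℂ = 0 := by
      have h1 : ⟪unitZeta ℓ, f⟫_ℂ = 0 := hf _ (Submodule.subset_span ⟨ℓ, rfl⟩)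
      have h2 : ⟪(⟨zeta (ℓ + 1), zeta_mem_V _⟩ : V 1), f⟫_ℂ = 0 := by
        rw [zeta_eq_smul_unitZeta]
        change ⟪(‖zeta (ℓ + 1)‖ : ℂ) • (unitZeta ℓ : L2), (f : L2)⟫_ℂ = 0
        rw [inner_smul_left, show ⟪(unitZeta ℓ : L2), (f : L2)⟫_ℂ = 0 from h1, mul_zero]
      exact h2
    exact Subtype.ext (eq_zero_of_inner_zeta f.2 h)

theorem zetaBasis_apply (ℓ : ℕ) : zetaBasis ℓ = unitZeta ℓ := by
  rw [zetaBasis, HilbertBasis.coe_mkOfOrthogonalEqBot]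

theorem repr_zetaBasis_zero_eq_zero_iff (f : V 1) :
    zetaBasis.repr f 0 = 0 ↔ ⟪zeta 1, (f : L2)⟫_ℂ = 0 := by
  have h : ‖zeta 1‖ ≠ 0 := norm_ne_zero_iff.2 (zeta_ne_zero 0)
  rw [HilbertBasis.repr_apply_apply, zetaBasis_apply, Submodule.coe_inner, coe_unitZeta,
    inner_smul_left]
  simp [h]

theorem abs_inv_laplacian_eigenvalue_le (ℓ : ℕ) : |(-1 / ((ℓ + 1) * (ℓ + 2)) : ℝ)| ≤ 1 := by
  rw [abs_div, abs_neg, abs_one, abs_of_pos (by positivity), div_le_one (by positivity)]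
  nlinarith [(Nat.cast_nonneg ℓ : (0 : ℝ) ≤ ℓ)]

/-- The inverse of the Laplace-Beltrami operator on `V₁`. -/
noncomputable def invLap : V 1 →L[ℂ] V 1 :=
  -- The basis is indexed from `0`: index `ℓ` belongs to `ζ_{ℓ+1}`, with Laplace eigenvalue
  -- `-(ℓ+1)(ℓ+2)`.
  diagOp zetaBasis (fun ℓ => -1 / ((ℓ + 1) * (ℓ + 2))) ⟨1, abs_inv_laplacian_eigenvalue_le⟩

/-- For a fixed test function both sides are bounded linear functionals of `ζ`, so it suffices to
check the eigenfunctions, whose span is dense. -/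
theorem isWeakLaplacian_invLap (ζ : V 1) : IsWeakLaplacian (invLap ζ) ζ := by
  intro Φ hΦ
  have h : (pairing ⟨sphereLaplacian Φ, continuous_sphereLaplacian hΦ⟩ ∘L (V 1).subtypeL) ∘L invLap
      = pairing (restrictSphere hΦ) ∘L (V 1).subtypeL := by
    refine ContinuousLinearMap.ext_on (s := Set.range zetaBasis)
      (Submodule.dense_iff_topologicalClosure_eq_top.2 zetaBasis.dense_span) ?_
    rintro _ ⟨ℓ, rfl⟩
    have h1 := isWeakLaplacian_zeta (ℓ + 1) Φ hΦ
    have h2 := integral_smul_mul (-(((ℓ + 1 : ℕ) : ℂ) * ((ℓ + 1 : ℕ) + 1))) (zeta (ℓ + 1))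
      (restrictSphere hΦ)
    have h3 : (ℓ : ℂ) + 1 ≠ 0 := by exact_mod_cast Nat.succ_ne_zero ℓ
    have h4 : (ℓ : ℂ) + 2 ≠ 0 := by exact_mod_cast Nat.succ_ne_zero (ℓ + 1)
    have hb : invLap (zetaBasis ℓ) = ((-1 / ((ℓ + 1) * (ℓ + 2)) : ℝ) : ℂ) • zetaBasis ℓ :=
      diagOp_basis _ _ _ ℓ
    rw [zetaBasis_apply] at hb
    simp only [ContinuousLinearMap.comp_apply, hb, map_smul, zetaBasis_apply,
      Submodule.subtypeL_apply, coe_unitZeta, pairing_apply, smul_eq_mul, restrictSphere,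
      ContinuousMap.coe_mk] at h2 ⊢
    rw [h1, h2]
    push_cast
    field_simp
    ring
  have h' := DFunLike.congr_fun h ζ
  simpa [pairing_apply, restrictSphere] using h'

theorem IsWeakLaplacian.eq {η₁ η₂ ζ : L2} (h₁ : η₁ ∈ L2b) (h₂ : η₂ ∈ L2b)
    (w₁ : IsWeakLaplacian η₁ ζ) (w₂ : IsWeakLaplacian η₂ ζ) : η₁ = η₂ := by
  rw [← sub_eq_zero]
  refine eq_zero_of_isWeakLaplacian_zero (L2b.sub_mem h₁ h₂) fun Φ hΦ => ?_
  have h := map_sub (pairing ⟨sphereLaplacian Φ, continuous_sphereLaplacian hΦ⟩) η₁ η₂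
  simp only [pairing_apply, ContinuousMap.coe_mk] at h
  rw [h, w₁ Φ hΦ, w₂ Φ hΦ, sub_self]
  exact (integral_zero_mul (restrictSphere hΦ)).symm

theorem existsUnique_isWeakLaplacian {ζ : L2} (hζ : ζ ∈ V 1) :
    ∃! η : L2, η ∈ L2b ∧ IsWeakLaplacian η ζ :=
  ⟨invLap ⟨ζ, hζ⟩, ⟨(invLap ⟨ζ, hζ⟩).2.1, isWeakLaplacian_invLap ⟨ζ, hζ⟩⟩,
    fun _ h => h.2.eq h.1 (invLap ⟨ζ, hζ⟩).2.1 (isWeakLaplacian_invLap ⟨ζ, hζ⟩)⟩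

theorem invLaplacian_eq (ζ : V 1) : invLaplacian ζ = invLap ζ := by
  have h : ∃ η : L2, η ∈ L2b ∧ IsWeakLaplacian η ζ := (existsUnique_isWeakLaplacian ζ.2).exists
  rw [invLaplacian, dif_pos h]
  exact h.choose_spec.2.eq h.choose_spec.1 (invLap ζ).2.1 (isWeakLaplacian_invLap ζ)

/-! ### Multiplication by `x₃` -/

theorem coeFn_mulZonal (a : C(ℝ, ℝ)) (f : L2) :
    mulZonal a f =ᵐ[area] fun x => zonal a x * f x :=
  MemLp.coeFn_toLp _

theorem integral_mulZonal_mul (a : C(ℝ, ℝ)) (f : L2) (g : S2 → ℂ) :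
    ∫ x, mulZonal a f x * g x ∂area = ∫ x, f x * (zonal a x * g x) ∂area := by
  refine integral_congr_ae ?_
  filter_upwards [coeFn_mulZonal a f] with x hx
  rw [hx]
  ring

theorem mulZonal_add (a : C(ℝ, ℝ)) (f g : L2) :
    mulZonal a (f + g) = mulZonal a f + mulZonal a g := by
  refine Lp.ext ?_
  filter_upwards [coeFn_mulZonal a (f + g), coeFn_mulZonal a f, coeFn_mulZonal a g,
    Lp.coeFn_add f g, Lp.coeFn_add (mulZonal a f) (mulZonal a g)] with x h1 h2 h3 h4 h5
  rw [h1, h5, h4, Pi.add_apply, Pi.add_apply, h2, h3, mul_add]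

theorem mulZonal_smul (a : C(ℝ, ℝ)) (c : ℂ) (f : L2) : mulZonal a (c • f) = c • mulZonal a f := by
  refine Lp.ext ?_
  filter_upwards [coeFn_mulZonal a (c • f), coeFn_mulZonal a f, Lp.coeFn_smul c f,
    Lp.coeFn_smul c (mulZonal a f)] with x h1 h2 h3 h4
  rw [h1, h4, h3, Pi.smul_apply, Pi.smul_apply, h2, smul_eq_mul, smul_eq_mul, mul_left_comm]

/-- This is where `Ω = 0` enters: `B = 6A` lets `M` factor as `x₃ (I + 6Δ⁻¹)`. -/
theorem mulZonal_B₂ (f : L2) : mulZonal (B₂ 0) f = mulZonal A₂ ((6 : ℂ) • f) := by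
  refine Lp.ext ?_
  filter_upwards [coeFn_mulZonal (B₂ 0) f, coeFn_mulZonal A₂ ((6 : ℂ) • f),
    Lp.coeFn_smul (6 : ℂ) f] with x h1 h2 h3
  rw [h1, h2, h3]
  simp [zonal, A₂, B₂]
  ring

theorem M_eq_mulZonal (f : L2) : M A₂ (B₂ 0) f = mulZonal A₂ (f + (6 : ℂ) • invLaplacian f) := by
  rw [M, mulZonal_B₂, mulZonal_add]

theorem zonal_A₂_apply (x : S2) : zonal A₂ x = polyFun (MvPolynomial.X 2) x := by
  simp [zonal, A₂, polyFun]

theorem rotDeriv_X_two (x : E3) : rotDeriv 0 1 (polyFun (MvPolynomial.X 2)) x = 0 := by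
  rw [rotDeriv_polyFun, rotDerivation_apply]
  simp [MvPolynomial.pderiv_X, polyFun]

/-- Since `X₃ x₃ = 0`, the factor `x₃` can be moved onto the test function. Testing with `x₃` itself
yields the mean-zero condition. -/
theorem mulZonal_A₂_mem_V {f : L2} (hf : f ∈ V 1) : mulZonal A₂ f ∈ V 1 := by
  have hX := contDiff_polyFun (MvPolynomial.X 2)
  refine ⟨?_, fun Φ hΦ => ?_⟩
  · have h := hf.2 _ hX
    simp only [X3_eq_rotDeriv, rotDeriv_X_two, mul_zero, integral_zero, neg_zero] at h
    have h1 := integral_mulZonal_mul A₂ f 1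
    simp only [Pi.one_apply, mul_one, zonal_A₂_apply] at h1
    refine h1.trans ((mul_eq_zero.1 h.symm).resolve_left ?_)
    simp
  · have h := hf.2 _ (hX.mul hΦ)
    rw [integral_mulZonal_mul, integral_mulZonal_mul]
    simp only [X3_eq_rotDeriv] at h ⊢
    simp only [rotDeriv_mul 0 1 hX hΦ, rotDeriv_X_two, zero_mul, add_zero] at h
    simpa only [zonal_A₂_apply] using h

/-- Multiplication by `x₃` on `V₁`. -/
noncomputable def mulX₃ : V 1 →ₗ[ℂ] V 1 where
  toFun f := ⟨mulZonal A₂ f, mulZonal_A₂_mem_V f.2⟩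
  map_add' _ _ := Subtype.ext (mulZonal_add _ _ _)
  map_smul' _ _ := Subtype.ext (mulZonal_smul _ _ _)

theorem isSymmetric_mulX₃ : mulX₃.IsSymmetric := by
  intro f g
  change ⟪mulZonal A₂ (f : L2), (g : L2)⟫_ℂ = ⟪(f : L2), mulZonal A₂ (g : L2)⟫_ℂ
  rw [L2.inner_def, L2.inner_def]
  refine integral_congr_ae ?_
  filter_upwards [coeFn_mulZonal A₂ (f : L2), coeFn_mulZonal A₂ (g : L2)] with x h1 h2
  rw [h1, h2, RCLike.inner_apply, RCLike.inner_apply]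
  simp [zonal]
  ring

/-- Multiplication by `x₃` on `V₁`, as a bounded operator. -/
noncomputable def mulX₃L : V 1 →L[ℂ] V 1 := ⟨mulX₃, isSymmetric_mulX₃.continuous⟩

theorem isSelfAdjoint_mulX₃L : IsSelfAdjoint mulX₃L :=
  ContinuousLinearMap.isSelfAdjoint_iff_isSymmetric.2 isSymmetric_mulX₃

theorem coe_mulX₃L (f : V 1) : (mulX₃L f : L2) = mulZonal A₂ f := rfl

theorem derivative_legendre_one : derivative (legendre 1) = 1 := by
  have h : (X ^ 2 - 1 : ℝ[X]) = X * X - 1 := by ring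
  simp [legendre, h, derivative_mul, ← two_mul, ← C_ofNat]
  rw [← C_mul]
  norm_num

theorem derivative_legendre_two : derivative (legendre 2) = 3 * X := by
  have h : (X ^ 2 - 1 : ℝ[X]) ^ 2 = X ^ 4 - C 2 * X ^ 2 + 1 := by
    rw [C_ofNat]
    ring
  have h24 : (C (1 / 8) * C 24 : ℝ[X]) = C 3 := by
    rw [← C_mul]
    norm_num
  have h' : derivative^[2 + 1] ((X ^ 2 - 1 : ℝ[X]) ^ 2) = C 24 * X := by
    rw [h]
    simp only [Function.iterate_succ_apply, Function.iterate_zero_apply, derivative_add,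
      derivative_sub, derivative_C_mul, derivative_X_pow, derivative_one]
    simp
    rw [show (C 24 : ℝ[X]) = C 4 * C 3 * C 2 by rw [← C_mul, ← C_mul]; norm_num]
    ring
  rw [legendre, derivative_C_mul, ← Function.iterate_succ_apply' derivative, h', ← mul_assoc,
    show (2 : ℝ) ^ 2 * (Nat.factorial 2 : ℝ) = 8 by norm_num [Nat.factorial], h24, C_ofNat]

/-- `P₁' = 1` and `P₂' = 3x₃`, so only the normalizations differ: `√(3/4) = 3√(5/12)/√5`. -/
theorem mulZonal_zeta_one : mulZonal A₂ (zeta 1) = ((Real.sqrt 5 : ℂ))⁻¹ • zeta 2 := by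
  have hc : Real.sqrt ((2 * (1 : ℕ) + 1) / (2 * (1 : ℕ) * ((1 : ℕ) + 1)))
      = (Real.sqrt 5)⁻¹ * (Real.sqrt ((2 * (2 : ℕ) + 1) / (2 * (2 : ℕ) * ((2 : ℕ) + 1))) * 3) := by
    refine (Real.sqrt_eq_iff_mul_self_eq (by norm_num) (by positivity)).2 ?_
    rw [← pow_two, mul_pow, mul_pow, inv_pow, Real.sq_sqrt (by norm_num),
      Real.sq_sqrt (by norm_num)]
    norm_num
  refine Lp.ext ?_
  filter_upwards [coeFn_mulZonal A₂ (zeta 1), Lp.coeFn_smul ((Real.sqrt 5 : ℂ))⁻¹ (zeta 2),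
    ContinuousMap.coeFn_toLp (p := 2) (𝕜 := ℂ) area (zetaFun 1),
    ContinuousMap.coeFn_toLp (p := 2) (𝕜 := ℂ) area (zetaFun 2)] with x h1 h2 h3 h4
  rw [h1, h2, Pi.smul_apply, zeta, h3, zeta, h4]
  simp only [zonal, A₂, zetaFun, ContinuousMap.coe_mk, derivative_legendre_one,
    derivative_legendre_two, hc]
  simp
  ring

/-! ### The operators `I + 6Δ⁻¹` and `M₁` -/

theorem abs_shifted_eigenvalue_le (ℓ : ℕ) : |(1 - 6 / ((ℓ + 1) * (ℓ + 2)) : ℝ)| ≤ 7 := by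
  have h := abs_inv_laplacian_eigenvalue_le ℓ
  have h1 : (1 - 6 / ((ℓ + 1) * (ℓ + 2)) : ℝ) = 1 + 6 * (-1 / ((ℓ + 1) * (ℓ + 2))) := by ring
  rw [h1]
  rw [abs_le] at h ⊢
  constructor <;> linarith [h.1, h.2]

/-- The operator `I + 6 Δ⁻¹` on `V₁`. -/
noncomputable def shiftedInvLap : V 1 →L[ℂ] V 1 :=
  diagOp zetaBasis (fun ℓ => 1 - 6 / ((ℓ + 1) * (ℓ + 2))) ⟨7, abs_shifted_eigenvalue_le⟩

theorem shiftedInvLap_apply (f : V 1) : shiftedInvLap f = f + (6 : ℂ) • invLap f := by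
  refine eq_of_repr_eq zetaBasis fun ℓ => ?_
  rw [shiftedInvLap, repr_diagOp, map_add, map_smul, lp.coeFn_add, Pi.add_apply, lp.coeFn_smul,
    Pi.smul_apply, invLap, repr_diagOp, smul_eq_mul]
  push_cast
  ring

theorem coe_shiftedInvLap (f : V 1) :
    (shiftedInvLap f : L2) = f + (6 : ℂ) • invLaplacian f := by
  rw [shiftedInvLap_apply, invLaplacian_eq]
  rfl

/-- The bound is attained at index `1`, where `(ℓ+1)(ℓ+2) = 6`; this puts `ζ₂` in the kernel. Index
`0` gives `-2`. -/
theorem shifted_eigenvalue_nonneg {ℓ : ℕ} (h : ℓ ≠ 0) :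
    (0 : ℝ) ≤ 1 - 6 / ((ℓ + 1) * (ℓ + 2)) := by
  have h1 : (1 : ℝ) ≤ ℓ := by exact_mod_cast Nat.one_le_iff_ne_zero.2 h
  rw [sub_nonneg, div_le_one (by positivity)]
  nlinarith

/-- `ζ_ℓ` as an element of `V₁`. -/
noncomputable def zetaV (ℓ : ℕ) : V 1 := ⟨zeta ℓ, zeta_mem_V ℓ⟩

theorem shiftedInvLap_zetaV (ℓ : ℕ) :
    shiftedInvLap (zetaV (ℓ + 1)) = ((1 - 6 / ((ℓ + 1) * (ℓ + 2)) : ℝ) : ℂ) • zetaV (ℓ + 1) := by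
  rw [zetaV, zeta_eq_smul_unitZeta, map_smul, ← zetaBasis_apply, shiftedInvLap, diagOp_basis,
    smul_comm]

theorem shiftedInvLap_zetaV_one : shiftedInvLap (zetaV 1) = (-2 : ℂ) • zetaV 1 := by
  have h := shiftedInvLap_zetaV 0
  norm_num at h
  rw [h, neg_smul]

theorem shiftedInvLap_zetaV_two : shiftedInvLap (zetaV 2) = 0 := by
  have h := shiftedInvLap_zetaV 1
  norm_num at h
  exact h

theorem mulX₃L_zetaV_one : mulX₃L (zetaV 1) = ((Real.sqrt 5 : ℂ))⁻¹ • zetaV 2 :=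
  Subtype.ext mulZonal_zeta_one

/-- The operator `M₁`. -/
noncomputable def M₁ : V 1 →L[ℂ] V 1 := mulX₃L * shiftedInvLap

theorem M₁_apply (f : V 1) : M₁ f = mulX₃L (shiftedInvLap f) := rfl

theorem coe_M₁ (f : V 1) : (M₁ f : L2) = M A₂ (B₂ 0) f := by
  rw [M₁_apply, coe_mulX₃L, coe_shiftedInvLap, M_eq_mulZonal]

theorem isSymmetric_shiftedInvLap (f g : V 1) :
    ⟪shiftedInvLap f, g⟫_ℂ = ⟪f, shiftedInvLap g⟫_ℂ :=
  ContinuousLinearMap.isSelfAdjoint_iff_isSymmetric.1 (isSelfAdjoint_diagOp _ _ _) f g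

/-- Both factors of `M₁` are symmetric, and moving them to the left produces `(I + 6Δ⁻¹)(x₃ζ₁)`, a
multiple of `(I + 6Δ⁻¹)ζ₂ = 0`. -/
theorem inner_zeta_one_M₁ (f : V 1) : ⟪zeta 1, (M₁ f : L2)⟫_ℂ = 0 := by
  change ⟪zetaV 1, mulX₃L (shiftedInvLap f)⟫_ℂ = 0
  have h : ⟪mulX₃L (zetaV 1), shiftedInvLap f⟫_ℂ = ⟪zetaV 1, mulX₃L (shiftedInvLap f)⟫_ℂ :=
    isSymmetric_mulX₃ (zetaV 1) (shiftedInvLap f)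
  rw [← h, mulX₃L_zetaV_one, ← isSymmetric_shiftedInvLap, map_smul, shiftedInvLap_zetaV_two,
    smul_zero, inner_zero_left]

theorem im_eq_zero_of_mem_spectrum_M₁ {z : ℂ} (hz : z ∈ spectrum ℂ M₁) : z.im = 0 :=
  im_eq_zero_of_mem_spectrum_mul_diagOp zetaBasis _ _ 0
    (fun _ h => shifted_eigenvalue_nonneg h) isSelfAdjoint_mulX₃L
    (fun f => (repr_zetaBasis_zero_eq_zero_iff _).2 (inner_zeta_one_M₁ f)) hz

/-! ### The subspace `V₁₂` and positivity -/

theorem V12_le_V : V12 ≤ V 1 := by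
  refine Submodule.topologicalClosure_minimal _ (Submodule.span_le.2 ?_) isClosed_V_one
  rintro _ ⟨ℓ, -, rfl⟩
  exact zeta_mem_V ℓ

theorem V12_le_ker_inner_zeta_one : V12 ≤ (innerSL ℂ (zeta 1)).ker := by
  refine Submodule.topologicalClosure_minimal _ (Submodule.span_le.2 ?_)
    (innerSL ℂ (zeta 1)).isClosed_ker
  rintro _ ⟨ℓ, hℓ, rfl⟩
  exact inner_zeta_zeta (by omega)

/-- For the converse, `f` minus its projection to `V12` lies in `V 1` and is orthogonal to every
`ζ_ℓ` with `ℓ ≥ 1`, so completeness makes it vanish. -/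
theorem mem_V12_iff {f : L2} : f ∈ V12 ↔ f ∈ V 1 ∧ ⟪zeta 1, f⟫_ℂ = 0 := by
  constructor
  · exact fun hf => ⟨V12_le_V hf, V12_le_ker_inner_zeta_one hf⟩
  · rintro ⟨hf, h1⟩
    have : CompleteSpace V12 := (Submodule.isClosed_topologicalClosure _).completeSpace_coe
    have hp := V12.starProjection_apply_mem f
    have hw := V12.sub_starProjection_mem_orthogonal f
    have hz (ℓ : ℕ) (hℓ : 2 ≤ ℓ) : zeta ℓ ∈ V12 :=
      Submodule.le_topologicalClosure _ (Submodule.subset_span ⟨ℓ, hℓ, rfl⟩)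
    have h0 : f - V12.starProjection f = 0 := by
      refine eq_zero_of_inner_zeta ((V 1).sub_mem hf (V12_le_V hp)) fun ℓ => ?_
      rcases Nat.eq_zero_or_pos ℓ with rfl | hℓ
      · rw [inner_sub_right, h1, show ⟪zeta (0 + 1), V12.starProjection f⟫_ℂ = 0 from
          V12_le_ker_inner_zeta_one hp, sub_zero]
      · exact hw _ (hz _ (by omega))
    rw [sub_eq_zero.1 h0]
    exact hp

/-- The inclusion of `V₁₂` into `V₁`. -/
noncomputable def inclV12 : V12 →L[ℂ] V 1 :=
  V12.subtypeL.codRestrict (V 1) fun f => V12_le_V f.2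

theorem repr_inclV12_zero (f : V12) : zetaBasis.repr (inclV12 f) 0 = 0 :=
  (repr_zetaBasis_zero_eq_zero_iff _).2 (mem_V12_iff.1 f.2).2

theorem shiftedInvLap_mem_V12 (f : V12) : (shiftedInvLap (inclV12 f) : L2) ∈ V12 := by
  refine mem_V12_iff.2 ⟨(shiftedInvLap (inclV12 f)).2, (repr_zetaBasis_zero_eq_zero_iff _).1 ?_⟩
  rw [shiftedInvLap, repr_diagOp, repr_inclV12_zero, mul_zero]

/-- The operator `I + 6 Δ⁻¹` on `V₁₂`. -/
noncomputable def shiftedInvLapV12 : V12 →L[ℂ] V12 :=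
  ((V 1).subtypeL ∘L shiftedInvLap ∘L inclV12).codRestrict V12 shiftedInvLap_mem_V12

theorem isPositive_shiftedInvLapV12 : shiftedInvLapV12.IsPositive := by
  refine ⟨fun f g => isSymmetric_shiftedInvLap (inclV12 f) (inclV12 g), fun f => ?_⟩
  refine re_inner_diagOp_nonneg zetaBasis _ ⟨7, abs_shifted_eigenvalue_le⟩ (x := inclV12 f) fun ℓ => ?_
  rcases eq_or_ne ℓ 0 with rfl | h
  · exact Or.inr (repr_inclV12_zero f)
  · exact Or.inl (shifted_eigenvalue_nonneg h)

/-! ### The Jordan block and linear growth -/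

theorem M₁_zetaV_one : M₁ (zetaV 1) = (-(2 / Real.sqrt 5) : ℂ) • zetaV 2 := by
  rw [M₁_apply, shiftedInvLap_zetaV_one, map_smul, mulX₃L_zetaV_one, smul_smul]
  congr 1
  ring

theorem M₁_M₁_zetaV_one : M₁ (M₁ (zetaV 1)) = 0 := by
  rw [M₁_zetaV_one, map_smul, M₁_apply, shiftedInvLap_zetaV_two, map_zero, smul_zero]

theorem zetaV_ne_zero (ℓ : ℕ) : zetaV (ℓ + 1) ≠ 0 :=
  fun h => zeta_ne_zero ℓ (congrArg Subtype.val h)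

theorem expGroup_M₁_zetaV_one (t : ℝ) : expGroup M₁ t (zetaV 1)
    = zetaV 1 - (2 * Complex.I * (t : ℂ) / (Real.sqrt 5 : ℂ)) • zetaV 2 := by
  rw [expGroup, exp_apply_of_apply_apply_eq_zero]
  · rw [smul_apply, M₁_zetaV_one, smul_smul, sub_eq_add_neg, ← neg_smul]
    congr 2
    ring
  · simp only [smul_apply, map_smul, M₁_M₁_zetaV_one, smul_zero]

theorem not_bounded_expGroup_M₁ : ¬ ∃ C : ℝ, ∀ t : ℝ, ‖expGroup M₁ t‖ ≤ C := by
  rintro ⟨C, hC⟩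
  have hC0 : 0 ≤ C := (norm_nonneg (expGroup M₁ 0)).trans (hC 0)
  have h5 : 0 < Real.sqrt 5 := by positivity
  have h2 : 0 < ‖zetaV 2‖ := norm_pos_iff.2 (zetaV_ne_zero 1)
  set n := ‖zetaV 1‖ with hn
  have hn0 : 0 ≤ n := norm_nonneg _
  -- Chosen so that the `ζ₂` term has norm `(C + 1)n + 1`; after subtracting `‖ζ₁‖ = n` this still
  -- exceeds the assumed bound `C n`.
  set t : ℝ := Real.sqrt 5 / 2 * (((C + 1) * n + 1) / ‖zetaV 2‖) with ht
  have ht0 : 0 ≤ t := by positivity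
  have h1 : ‖expGroup M₁ t (zetaV 1)‖ ≤ C * n :=
    (ContinuousLinearMap.le_opNorm _ _).trans (mul_le_mul_of_nonneg_right (hC t) hn0)
  rw [expGroup_M₁_zetaV_one] at h1
  have h3 : ‖(2 * Complex.I * (t : ℂ) / (Real.sqrt 5 : ℂ)) • zetaV 2‖ = (C + 1) * n + 1 := by
    rw [norm_smul, norm_div, norm_mul, norm_mul, Complex.norm_I, Complex.norm_real,
      Complex.norm_real, Real.norm_of_nonneg ht0, Real.norm_of_nonneg h5.le, Complex.norm_ofNat, ht]
    field_simp
  have h4 := norm_sub_norm_le ((2 * Complex.I * (t : ℂ) / (Real.sqrt 5 : ℂ)) • zetaV 2) (zetaV 1)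
  rw [norm_sub_rev, h3] at h4
  nlinarith

end ZonalFlow

open ZonalFlow in
theorem proposition5p1p1 :
    -- `Δ⁻¹` is well defined on `V₁`
    (∀ ζ ∈ V 1, ∃! η : L2, η ∈ L2b ∧ IsWeakLaplacian η ζ) ∧
    -- `M₁`, the restriction of `M` to `V₁`, is a bounded operator on `V₁`
    ∃ M₁ : V 1 →L[ℂ] V 1,
      (∀ ζ : V 1, (M₁ ζ : L2) = M A₂ (B₂ 0) ζ) ∧
      -- `M₁` has only real spectrum
      (∀ z ∈ spectrum ℂ M₁, z.im = 0) ∧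
      -- the range of `M₁` lies in `V₁₂ ⊆ V₁`
      V12 ≤ V 1 ∧
      (∀ ζ : V 1, (M₁ ζ : L2) ∈ V12) ∧
      -- on `V₁₂`, `M₁ = x₃ (I + 6 Δ⁻¹)`, and `I + 6 Δ⁻¹` is positive semidefinite there
      (∃ T : V12 →L[ℂ] V12, T.IsPositive ∧
        (∀ ζ : V12, (T ζ : L2) = (ζ : L2) + (6 : ℂ) • invLaplacian ζ) ∧
        ∀ (ζ : V 1) (hζ : (ζ : L2) ∈ V12),
          (M₁ ζ : L2) = mulZonal A₂ (T ⟨ζ, hζ⟩ : L2)) ∧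
      -- weak linear instability: a generalized `0`-eigenvector, and unboundedness of `e^{itM₁}`
      (∃ ζ₁ ζ₂ : V 1, (ζ₁ : L2) = zeta 1 ∧ (ζ₂ : L2) = zeta 2 ∧
        M₁ ζ₁ ≠ 0 ∧ M₁ (M₁ ζ₁) = 0 ∧
        ∀ t : ℝ, expGroup M₁ t ζ₁
          = ζ₁ - (2 * Complex.I * (t : ℂ) / (Real.sqrt 5 : ℂ)) • ζ₂) ∧
      ¬ ∃ C : ℝ, ∀ t : ℝ, ‖expGroup M₁ t‖ ≤ C := by
  refine ⟨fun ζ hζ => existsUnique_isWeakLaplacian hζ, M₁, coe_M₁,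
    fun z hz => im_eq_zero_of_mem_spectrum_M₁ hz, V12_le_V,
    fun ζ => mem_V12_iff.2 ⟨(M₁ ζ).2, inner_zeta_one_M₁ ζ⟩,
    ⟨shiftedInvLapV12, isPositive_shiftedInvLapV12, fun ζ => coe_shiftedInvLap (inclV12 ζ),
      fun ζ hζ => rfl⟩,
    ⟨zetaV 1, zetaV 2, rfl, rfl, ?_, M₁_M₁_zetaV_one, expGroup_M₁_zetaV_one⟩,
    not_bounded_expGroup_M₁⟩
  rw [M₁_zetaV_one]
  exact smul_ne_zero (by simp) (zetaV_ne_zero 1)
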